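/- Let $\mathbb T=\mathbb R/2\pi\mathbb Z$, $\alpha,\beta\in\mathbb R$ with $\alpha\neq0$, and assume $\frac{3\beta}{5\alpha}\neq k_1^2+k_2^2+k_1k_2$ for all $k_1,k_2\in\mathbb Z\setminus\{0\}$. Write $u_k=\frac1{2\pi}\int_0^{2\pi}e^{-ikx}u(x)\,dx$, $\langle x\rangle=1+|x|$, $\|\cdot\|=\|\cdot\|_{L^2(\mathbb T)}$, $\|u\|_{H^s}=\|\langle k\rangle^su_k\|_{\ell^2_k}$, and let $\dot L^2$ be the space of mean-zero functions in $L^2(\mathbb T)$ (complex-valued, in particular real-valued). For functions with mean zero in $x$ define Fourier coefficients, for $k\ne0$, by $$\mathcal B(\phi,\psi)_k=-\frac12\sum_{k_1+k_2=k}\frac{\phi_{k_1}\psi_{k_2}}{k_1k_2\{5\alpha(k_1^2+k_2^2+k_1k_2)-3\beta\}},\qquad \rho(u)_k=\frac{i|u_k|^2u_k}{2(15\alpha k^2-3\beta)k},$$ $$\sigma(u)_k=-iu_k\sum_{|j|\neq|k|}\frac{|u_j|^2}{j\{5\alpha(k^2-kj+j^2)-3\beta\}},$$ $$\mathcal R(u)_k=-\frac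 i2\sum_{\substack{k_1+k_2+k_3=k\\(k_1+k_2)(k_2+k_3)(k_3+k_1)\neq0}}\frac{u_{k_1}u_{k_2}u_{k_3}}{k_1\{5\alpha(k_1^2+(k_2+k_3)^2+k_1(k_2+k_3))-3\beta\}},$$ and $\mathcal B(\phi,\psi)_0=\rho(u)_0=\sigma(u)_0=\mathcal R(u)_0=0$; in the sums $k_1$, $k_2$ (for $\mathcal B$), $j$ (for $\sigma$) and $k_1$ (for $\mathcal R$) are nonzero. Let $$\|u\|_{X^{s,b}}=\|\langle k\rangle^s\langle\tau+\alpha k^5-\beta k^3\rangle^b\,\widehat u(k,\tau)\|_{\ell^2_kL^2_\tau},\qquad \|u\|_{X^{s,b}_\delta}=\inf\{\|\tilde u\|_{X^{s,b}}:\tilde u=u\text{ on }t\in[0,\delta]\},$$ where $\widehat u$ is the Fourier transform in $x$ and $t$, $\delta\ge0$, and the infimum (which is $\infty$ if there is no such $\tilde u$) is over distributions $\tilde u\in X^{s,b}$ on $\mathbb T\times\mathbb R$. Then the following hold. (1) There is $C=C(\alpha,\beta)$ such that for all $s\le3$ and $\phi,\psi,u\in\dot L^2$, the series defining $\mathcal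 B(\phi,\psi)_k$ converges absolutely for every $k\neq0$, and $$\|\mathcal B(\phi,\psi)\|_{H^s}\le C\|\phi\|\|\psi\|,\qquad \|\rho(u)\|_{H^s}\le C\|u\|^3.$$ (2) There is $C=C(\alpha,\beta)$ such that for all $s\le2$ and $u\in\dot L^2$, the series defining $\sigma(u)_k$ converges absolutely for every $k\neq0$, and $\|\sigma(u)\|_{H^s}\le C\|u\|^3$. (3) There is an absolute constant $\epsilon_0>0$ such that for every $0<\epsilon\le\epsilon_0$ there is $C=C(\alpha,\beta,\epsilon)$ such that for all $s\le2$, all $\delta\ge0$ and all $u\in L^2([0,\delta]\times\mathbb T)$ with mean zero in $x$ for a.e. $t$, the series defining $\mathcal R(u)_k(t)$ converges absolutely for a.e. $t\in[0,\delta]$ and every $k\neq0$, and $$\|\mathcal R(u)\|_{X^{s,-1/2+\epsilon}_\delta}\le C\|u\|^3_{X^{0,1/2}_\delta}.$$ -/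

import Mathlib

open MeasureTheory Set
open scoped ENNReal ContDiff

noncomputable section

namespace Kawahara

instance instFactTwoPiPos : Fact (0 < 2 * Real.pi) := ⟨Real.two_pi_pos⟩

/-- The torus `ℝ / 2πℤ`; its `volume` is Lebesgue measure, of total mass `2π`. -/
abbrev Torus : Type := AddCircle (2 * Real.pi)

/-- The bracket `⟨x⟩ = 1 + |x|`. -/
def bracket (x : ℝ) : ℝ := 1 + |x|

/-- The standing non-resonance condition on the dispersion coefficients. -/
def NonResonant (α β : ℝ) : Prop :=
  ∀ k₁ k₂ : ℤ, k₁ ≠ 0 → k₂ ≠ 0 →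
    3 * β / (5 * α) ≠ (k₁ : ℝ) ^ 2 + (k₂ : ℝ) ^ 2 + (k₁ : ℝ) * (k₂ : ℝ)

/-- The factor `5α(m² + n² + mn) - 3β`. -/
def denom (α β : ℝ) (m n : ℤ) : ℝ :=
  5 * α * ((m : ℝ) ^ 2 + (n : ℝ) ^ 2 + (m : ℝ) * (n : ℝ)) - 3 * β

/-- Mean-zero square integrable functions on the torus. -/
def IsDotL2 (φ : Torus → ℂ) : Prop := MemLp φ 2 volume ∧ ∫ x, φ x = 0

/-- The `L²` norm on the torus, with respect to Lebesgue measure. -/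
def l2Norm (φ : Torus → ℂ) : ℝ≥0∞ := eLpNorm φ 2 volume

/-- The `H^s` norm of the distribution on the torus with Fourier coefficients `c`
(the value is `∞` if it is not in `H^s`). -/
def hsNorm (s : ℝ) (c : ℤ → ℂ) : ℝ≥0∞ :=
  (∑' k : ℤ, ENNReal.ofReal (bracket k ^ (2 * s)) * ‖c k‖ₑ ^ 2) ^ (1 / 2 : ℝ)

/-! The multilinear expressions, as operations on sequences of Fourier coefficients.
Frequencies that occur as a factor of a denominator are nonzero. -/

/-- Summand of `B(φ,ψ)_k` with frequencies `k₁` and `k₂ = k - k₁`; `a`, `b` are the Fourier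
coefficients of `φ`, `ψ`. -/
def bTerm (α β : ℝ) (a b : ℤ → ℂ) (k k₁ : ℤ) : ℂ :=
  if k₁ ≠ 0 ∧ k - k₁ ≠ 0 then
    a k₁ * b (k - k₁) / (((k₁ : ℝ) * ((k - k₁ : ℤ) : ℝ) * denom α β k₁ (k - k₁) : ℝ) : ℂ)
  else 0

/-- `B(φ,ψ)_k`. -/
def bCoeff (α β : ℝ) (a b : ℤ → ℂ) (k : ℤ) : ℂ :=
  if k = 0 then 0 else -(1 / 2) * ∑' k₁ : ℤ, bTerm α β a b k k₁

/-- `ρ(u)_k`. -/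
def rhoCoeff (α β : ℝ) (u : ℤ → ℂ) (k : ℤ) : ℂ :=
  if k = 0 then 0 else
    Complex.I * ((‖u k‖ ^ 2 : ℝ) : ℂ) * u k
      / ((2 * (15 * α * (k : ℝ) ^ 2 - 3 * β) * (k : ℝ) : ℝ) : ℂ)

/-- Summand of `σ(u)_k` with frequency `j`. -/
def sigmaTerm (α β : ℝ) (u : ℤ → ℂ) (k j : ℤ) : ℝ :=
  if j ≠ 0 ∧ |j| ≠ |k| then
    ‖u j‖ ^ 2 /
      ((j : ℝ) * (5 * α * ((k : ℝ) ^ 2 - (k : ℝ) * (j : ℝ) + (j : ℝ) ^ 2) - 3 * β))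
  else 0

/-- `σ(u)_k`. -/
def sigmaCoeff (α β : ℝ) (u : ℤ → ℂ) (k : ℤ) : ℂ :=
  if k = 0 then 0 else -Complex.I * u k * ((∑' j : ℤ, sigmaTerm α β u k j : ℝ) : ℂ)

/-- The cubic summand of `R(u)_k` with frequencies `k₁, k₂, k₃`. -/
def cubicTerm (α β : ℝ) (u : ℤ → ℂ) (k₁ k₂ k₃ : ℤ) : ℂ :=
  if k₁ ≠ 0 ∧ (k₁ + k₂) * (k₂ + k₃) * (k₃ + k₁) ≠ 0 then
    u k₁ * u k₂ * u k₃ / (((k₁ : ℝ) * denom α β k₁ (k₂ + k₃) : ℝ) : ℂ)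
  else 0

/-- Summand of `R(u)_k`, indexed by `(k₁, k₂)`, where `k₃ = k - k₁ - k₂`. -/
def rTerm (α β : ℝ) (u : ℤ → ℂ) (k : ℤ) (p : ℤ × ℤ) : ℂ :=
  cubicTerm α β u p.1 p.2 (k - p.1 - p.2)

/-- `R(u)_k`. -/
def rCoeff (α β : ℝ) (u : ℤ → ℂ) (k : ℤ) : ℂ :=
  if k = 0 then 0 else -(Complex.I / 2) * ∑' p : ℤ × ℤ, rTerm α β u k p

/-! Bourgain spaces. A distribution on `𝕋 × ℝ` in `X^{s,b}` is given by its space-time Fourier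
transform `G k τ`; its `k`-th spatial Fourier coefficient is the tempered distribution
`φ ↦ ∫ G k τ (∫ e^{iτt} φ(t) dt) dτ` on `ℝ`, which is the inverse of the transform
`û(τ) = (2π)⁻¹ ∫ e^{-iτt} u(t) dt`. -/

/-- The `X^{s,b}` norm in terms of the space-time Fourier transform `G`. -/
def xNorm (α β s b : ℝ) (G : ℤ → ℝ → ℂ) : ℝ≥0∞ :=
  (∑' k : ℤ, ∫⁻ τ : ℝ,
    ENNReal.ofReal
      (bracket k ^ (2 * s) * bracket (τ + α * (k : ℝ) ^ 5 - β * (k : ℝ) ^ 3) ^ (2 * b))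
      * ‖G k τ‖ₑ ^ 2) ^ (1 / 2 : ℝ)

/-- The action on a test function of the distribution on `ℝ` with Fourier transform `g`. -/
def pairing (g : ℝ → ℂ) (φ : ℝ → ℂ) : ℂ :=
  ∫ τ : ℝ, g τ * ∫ t : ℝ, Complex.exp (Complex.I * (τ : ℂ) * (t : ℂ)) * φ t

/-- The distribution with space-time Fourier transform `G` is, on the time interval `[0,δ]`, the
locally integrable function with spatial Fourier coefficients `v k t`. -/
def IsExtension (δ : ℝ) (v G : ℤ → ℝ → ℂ) : Prop :=
  ∀ k : ℤ, AEStronglyMeasurable (G k) volume ∧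
    LocallyIntegrableOn (v k) (Ioo 0 δ) volume ∧
    ∀ φ : ℝ → ℂ, ContDiff ℝ ∞ φ → HasCompactSupport φ → tsupport φ ⊆ Ioo 0 δ →
      pairing (G k) φ = ∫ t : ℝ, v k t * φ t

/-- The restricted norm `X_δ^{s,b}` of the function on `[0,δ] × 𝕋` with spatial Fourier
coefficients `v k t`: the infimum of the `X^{s,b}` norms of all extensions (`∞` if there is
none). -/
def xRestrNorm (α β δ s b : ℝ) (v : ℤ → ℝ → ℂ) : ℝ≥0∞ :=
  ⨅ (G : ℤ → ℝ → ℂ) (_ : IsExtension δ v G), xNorm α β s b G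

/-- Spatial Fourier coefficients `u_k(t)` of a function of time and space. -/
def spaceCoeff (u : ℝ → Torus → ℂ) (k : ℤ) (t : ℝ) : ℂ := fourierCoeff (u t) k

/-- Spatial Fourier coefficients of `R(u)` for a function `u` of time and space. -/
def rSpaceCoeff (α β : ℝ) (u : ℝ → Torus → ℂ) (k : ℤ) (t : ℝ) : ℂ :=
  rCoeff α β (fourierCoeff (u t)) k

/-- `u` is square integrable on `[0,δ] × 𝕋`, with mean zero in space at almost every time. -/
def IsDotL2SpaceTime (δ : ℝ) (u : ℝ → Torus → ℂ) : Prop :=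
  MemLp (Function.uncurry u) 2 ((volume.restrict (Icc 0 δ)).prod volume) ∧
    ∀ᵐ t ∂(volume.restrict (Icc 0 δ)), ∫ x, u t x = 0

end Kawahara

end

namespace Kawahara

/-! ### Cauchy-Schwarz and Young inequalities for nonnegative functions -/

/-! Everything rests on two lower bounds. First, m² + n² + mn takes integer values, and integers
other than 3β/(5α) stay a fixed distance away from it. Hence nonresonance upgrades to |5α(m² + n² +
mn) - 3β| ≥ c(m² + n²) for nonzero m, n (`exists_denom_lower_bound`). With k = m + n the denominator
thus absorbs ⟨k⟩².

This settles the fixed-time estimates. For B, ⟨k⟩³ costs only 1/|k₁| + 1/|k₂|. Since 1/|k| is square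
summable, φ_k/k is in ℓ¹, and Young's inequality ℓ¹ * ℓ² ⊂ ℓ² concludes. For ρ one uses ℓ² ⊂ ℓ⁶, and
for σ the factor ⟨k⟩² leaves the sum of |u_j|².

For R the denominator again pays for ⟨k⟩² and leaves 1/|k₁|. The second lower bound concerns the
resonance function. With a, b, d the pairwise sums of k₁, k₂, k₃ it equals abd(5α(a² + b² + d²)/2 -
3β), so if abd ≠ 0 one of the four modulations is at least a multiple of (1 + |k₂|)²
(`exists_resonance_lower_bound`). For fixed frequencies this gains (1 + |k₂|)^(-3/4) in a weighted
triple convolution in τ (`lintegral_weighted_lconvolution_sq_le`). As 1/|k₁| and (1 + |k₂|)^(-3/4)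
are both square summable, Cauchy-Schwarz in (k₁, k₂) finishes the trilinear bound
(`exists_extMajorant_bound`), and no Strichartz estimate is needed.

It remains to see that convolving an extension of u yields an extension of R(u). Each coefficient of
the extension is an L² function V_k of time that agrees with u_k on (0,δ). Products of three of
them, tested against smooth φ, match the triple convolution (`integral_tripleConv_mul`), with enough
absolute convergence to exchange sums and integrals (`integrable_rCoeff_mul_test`). -/

theorem lintegral_mul_sq_le {X : Type*} [MeasurableSpace X] (μ : Measure X) {f g : X → ℝ≥0∞}
    (hf : AEMeasurable f μ) (hg : AEMeasurable g μ) :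
    (∫⁻ x, f x * g x ∂μ) ^ 2 ≤ (∫⁻ x, f x ^ 2 ∂μ) * ∫⁻ x, g x ^ 2 ∂μ := by
  have h := ENNReal.lintegral_mul_le_Lp_mul_Lq μ Real.HolderConjugate.two_two hf hg
  simp only [Pi.mul_apply, ENNReal.rpow_two] at h
  calc (∫⁻ x, f x * g x ∂μ) ^ 2
      ≤ ((∫⁻ x, f x ^ 2 ∂μ) ^ (1 / 2 : ℝ) * (∫⁻ x, g x ^ 2 ∂μ) ^ (1 / 2 : ℝ)) ^ 2 := by gcongr
    _ = _ := by
      rw [mul_pow, ← ENNReal.rpow_natCast, ← ENNReal.rpow_natCast, ← ENNReal.rpow_mul,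
        ← ENNReal.rpow_mul]
      norm_num

theorem sq_rpow_half (x : ℝ≥0∞) : (x ^ (1 / 2 : ℝ)) ^ 2 = x := by
  rw [← ENNReal.rpow_natCast, ← ENNReal.rpow_mul]
  norm_num

/-- Cauchy-Schwarz for the measure f dμ: split f into two square roots and give one of them to g. -/
theorem lintegral_mul_sq_le' {X : Type*} [MeasurableSpace X] (μ : Measure X) {f g : X → ℝ≥0∞}
    (hf : AEMeasurable f μ) (hg : AEMeasurable g μ) :
    (∫⁻ x, f x * g x ∂μ) ^ 2 ≤ (∫⁻ x, f x ∂μ) * ∫⁻ x, f x * g x ^ 2 ∂μ := by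
  have h := lintegral_mul_sq_le μ (hf.pow_const (1 / 2 : ℝ)) ((hf.pow_const (1 / 2 : ℝ)).mul hg)
  simpa only [Pi.mul_apply, mul_pow, sq_rpow_half, ← mul_assoc, ← sq] using h

theorem tsum_mul_sq_le {ι : Type*} (f g : ι → ℝ≥0∞) :
    (∑' i, f i * g i) ^ 2 ≤ (∑' i, f i ^ 2) * ∑' i, g i ^ 2 := by
  let _ : MeasurableSpace ι := ⊤
  simpa [lintegral_count] using lintegral_mul_sq_le (Measure.count : Measure ι)
    (measurable_from_top (f := f)).aemeasurable (measurable_from_top (f := g)).aemeasurable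

theorem lconvolution_le_mul_of_le {G : Type*} [MeasurableSpace G] [AddCommGroup G]
    {μ : Measure G} {f g : G → ℝ≥0∞} (hf : Measurable f) {c : ℝ≥0∞}
    (hg : ∀ x, g x ≤ c) (x : G) : (f ⋆ₗ[μ] g) x ≤ (∫⁻ x, f x ∂μ) * c := by
  rw [← lintegral_mul_const _ hf]
  exact lintegral_mono fun y ↦ by dsimp only; gcongr; exact hg _

theorem lconvolution_sq_le {G : Type*} [MeasurableSpace G] [AddCommGroup G] [MeasurableAdd₂ G]
    [MeasurableNeg G] {μ : Measure G} [μ.IsAddLeftInvariant] [μ.IsNegInvariant] {f g : G → ℝ≥0∞} (hf : Measurable f) (hg : Measurable g) (x : G) :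
    (f ⋆ₗ[μ] g) x ^ 2 ≤ (∫⁻ x, f x ^ 2 ∂μ) * ∫⁻ x, g x ^ 2 ∂μ := by
  refine (lintegral_mul_sq_le μ hf.aemeasurable (by fun_prop)).trans ?_
  refine mul_le_mul_right ?_ _
  calc ∫⁻ y, g (-y + x) ^ 2 ∂μ = ∫⁻ y, (fun z ↦ g (-z) ^ 2) (-x + y) ∂μ := by
        simp only [neg_add_rev, neg_neg]
    _ = ∫⁻ y, g (-y) ^ 2 ∂μ := lintegral_add_left_eq_self (fun z ↦ g (-z) ^ 2) (-x)
    _ ≤ _ := (lintegral_neg_eq_self (μ := μ) (fun y ↦ g y ^ 2)).le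

/-- L² * L² is bounded pointwise and convolution with an L¹ function preserves that. It serves when
the output variable carries its own square integrable weight. -/
theorem lconvolution_three_sq_le {G : Type*} [MeasurableSpace G] [AddCommGroup G]
    [MeasurableAdd₂ G] [MeasurableNeg G] {μ : Measure G} [μ.IsAddLeftInvariant]
    [μ.IsNegInvariant] {f g h : G → ℝ≥0∞} (hf : Measurable f)
    (hg : Measurable g) (hh : Measurable h) (x : G) :
    (f ⋆ₗ[μ] (g ⋆ₗ[μ] h)) x ^ 2 ≤
      (∫⁻ x, f x ∂μ) ^ 2 * ((∫⁻ x, g x ^ 2 ∂μ) * ∫⁻ x, h x ^ 2 ∂μ) := by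
  have h1 := lconvolution_le_mul_of_le (μ := μ) (f := f) (g := g ⋆ₗ[μ] h) hf
    (c := ((∫⁻ x, g x ^ 2 ∂μ) * ∫⁻ x, h x ^ 2 ∂μ) ^ (1 / 2 : ℝ)) (fun x ↦ by
      rw [one_div, ENNReal.le_rpow_inv_iff (by norm_num), ENNReal.rpow_two]
      exact lconvolution_sq_le hg hh x) x
  calc _ ≤ _ := pow_le_pow_left' h1 2
    _ = _ := by rw [mul_pow, sq_rpow_half]

section Young

variable {G : Type*} [MeasurableSpace G] [AddCommGroup G] [MeasurableAdd₂ G] [MeasurableNeg G]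
  {μ : Measure G} [μ.IsAddLeftInvariant] [SFinite μ]

theorem lintegral_lconvolution {f g : G → ℝ≥0∞} (hf : Measurable f) (hg : Measurable g) :
    ∫⁻ x, (f ⋆ₗ[μ] g) x ∂μ = (∫⁻ x, f x ∂μ) * ∫⁻ x, g x ∂μ := by
  simp only [lconvolution]
  rw [lintegral_lintegral_swap (by fun_prop)]
  have (y : G) : ∫⁻ x, f y * g (-y + x) ∂μ = f y * ∫⁻ x, g x ∂μ := by
    rw [lintegral_const_mul _ (by fun_prop), lintegral_add_left_eq_self]
  simp_rw [this]
  rw [lintegral_mul_const _ hf]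

theorem lintegral_lconvolution_sq_le {f g : G → ℝ≥0∞} (hf : Measurable f) (hg : Measurable g) :
    ∫⁻ x, (f ⋆ₗ[μ] g) x ^ 2 ∂μ ≤ (∫⁻ x, f x ∂μ) ^ 2 * ∫⁻ x, g x ^ 2 ∂μ := by
  calc ∫⁻ x, (f ⋆ₗ[μ] g) x ^ 2 ∂μ
      ≤ ∫⁻ x, (∫⁻ y, f y ∂μ) * (f ⋆ₗ[μ] fun x ↦ g x ^ 2) x ∂μ := by
        refine lintegral_mono fun x ↦ ?_
        exact lintegral_mul_sq_le' μ hf.aemeasurable (by fun_prop)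
    _ = _ := by
      rw [lintegral_const_mul _ (by fun_prop), lintegral_lconvolution hf (by fun_prop), sq,
        mul_assoc]

/-- Young's inequality twice, L¹ * L¹ * L² ⊂ L²: two of the three factors must be integrable. -/
theorem lintegral_lconvolution_three_sq_le {f g h : G → ℝ≥0∞} (hf : Measurable f)
    (hg : Measurable g) (hh : Measurable h) :
    ∫⁻ x, (f ⋆ₗ[μ] (g ⋆ₗ[μ] h)) x ^ 2 ∂μ ≤
      (∫⁻ x, f x ∂μ) ^ 2 * ((∫⁻ x, g x ∂μ) ^ 2 * ∫⁻ x, h x ^ 2 ∂μ) :=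
  (lintegral_lconvolution_sq_le hf (by fun_prop)).trans
    (by gcongr; exact lintegral_lconvolution_sq_le hg hh)

variable [μ.IsNegInvariant]

theorem lconvolution_left_comm {f g h : G → ℝ≥0∞} (hf : Measurable f)
    (hg : Measurable g) (hh : Measurable h) :
    f ⋆ₗ[μ] (g ⋆ₗ[μ] h) = g ⋆ₗ[μ] (f ⋆ₗ[μ] h) := by
  rw [lconvolution_assoc hf hg hh, lconvolution_comm (f := f), ← lconvolution_assoc hg hf hh]

end Young

theorem tsum_tsum_mul_sq_le (f g : ℤ → ℝ≥0∞) :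
    ∑' k, (∑' j, f j * g (k - j)) ^ 2 ≤ (∑' k, f k) ^ 2 * ∑' k, g k ^ 2 := by
  simpa [lintegral_count, lconvolution, neg_add_eq_sub] using
    lintegral_lconvolution_sq_le (μ := (Measure.count : Measure ℤ))
    (measurable_from_top (f := f)) (measurable_from_top (f := g))

theorem tsum_mul_sub_le (f g : ℤ → ℝ≥0∞) (k : ℤ) :
    (∑' j, f j * g (k - j)) ^ 2 ≤ (∑' k, f k ^ 2) * ∑' k, g k ^ 2 := by
  simpa [lintegral_count, lconvolution, neg_add_eq_sub] using
    lconvolution_sq_le (μ := (Measure.count : Measure ℤ))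
    (measurable_from_top (f := f)) (measurable_from_top (f := g)) k

/-- The weight `1 / |k|`, with value `0` at `k = 0`. -/
noncomputable def invWeight (k : ℤ) : ℝ≥0∞ := ENNReal.ofReal (1 / |(k : ℝ)|)

theorem tsum_invWeight_sq_ne_top : ∑' k, invWeight k ^ 2 ≠ ⊤ := by
  have h : Summable fun k : ℤ ↦ 1 / (k : ℝ) ^ 2 := Real.summable_one_div_int_pow.2 one_lt_two
  have h2 (k : ℤ) : invWeight k ^ 2 = ENNReal.ofReal (1 / (k : ℝ) ^ 2) := by
    rw [invWeight, ← ENNReal.ofReal_pow (by positivity), div_pow, one_pow, sq_abs]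
  simp_rw [h2]
  rw [← ENNReal.ofReal_tsum_of_nonneg (fun _ ↦ by positivity) h]
  exact ENNReal.ofReal_ne_top

theorem tsum_invWeight_mul_sq_le (a : ℤ → ℝ≥0∞) :
    (∑' k, invWeight k * a k) ^ 2 ≤ (∑' k, invWeight k ^ 2) * ∑' k, a k ^ 2 :=
  tsum_mul_sq_le _ _

/-- Trilinear summation over the frequencies `k₁ + k₂ + k₃ = k`. -/
theorem tsum_invWeight_mul_three_sq_le (a : ℤ → ℝ≥0∞) (k : ℤ) :
    (∑' p : ℤ × ℤ, invWeight p.1 * (a p.1 * (a p.2 * a (k - p.1 - p.2)))) ^ 2 ≤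
      (∑' k, invWeight k ^ 2) * (∑' k, a k ^ 2) ^ 3 := by
  -- For fixed k₁ Cauchy-Schwarz in k₂ removes two factors; the weight 1/|k₁| then makes the
  -- remaining sum over k₁ converge.
  have h (k₁ : ℤ) : ∑' k₂, a k₂ * a (k - k₁ - k₂) ≤ ∑' k, a k ^ 2 := by
    have := tsum_mul_sub_le a a (k - k₁)
    rw [← sq] at this
    exact (ENNReal.pow_le_pow_left_iff two_ne_zero).1 this
  rw [ENNReal.tsum_prod']
  calc _ ≤ (∑' k₁, invWeight k₁ * a k₁ * ∑' k, a k ^ 2) ^ 2 := by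
        gcongr with k₁
        simp only [← mul_assoc (invWeight k₁), ENNReal.tsum_mul_left]
        exact mul_le_mul_right (h k₁) _
    _ ≤ _ := by
        rw [ENNReal.tsum_mul_right, mul_pow, pow_succ _ 2, mul_comm (_ ^ 2) (∑' k, a k ^ 2),
          ← mul_assoc]
        gcongr
        exact tsum_invWeight_mul_sq_le a

/-! ### Fourier coefficients -/

theorem tsum_enorm_fourierCoeff_sq {φ : Torus → ℂ} (hφ : MemLp φ 2 volume) :
    ENNReal.ofReal (2 * Real.pi) * ∑' k, ‖fourierCoeff φ k‖ₑ ^ 2 = l2Norm φ ^ 2 := by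
  have hpi : ENNReal.ofReal (2 * Real.pi) ≠ 0 := by
    simp [Real.pi_pos]
  have hφ' : MemLp φ 2 AddCircle.haarAddCircle := by
    -- Fourier coefficients are normalised by the probability measure, the L² norm by Lebesgue
    -- measure of mass 2π; this is the origin of the factor.
    rw [AddCircle.volume_eq_smul_haarAddCircle] at hφ
    have := hφ.smul_measure (c := (ENNReal.ofReal (2 * Real.pi))⁻¹) (ENNReal.inv_ne_top.2 hpi)
    rwa [smul_smul, ENNReal.inv_mul_cancel hpi ENNReal.ofReal_ne_top, one_smul] at this
  have hae := hφ'.coeFn_toLp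
  have h := hasSum_sq_fourierCoeff (hφ'.toLp φ)
  rw [fourierCoeff_congr_ae hae] at h
  have h1 : ∑' k, ‖fourierCoeff φ k‖ₑ ^ 2 = ENNReal.ofReal (∑' k, ‖fourierCoeff φ k‖ ^ 2) := by
    rw [ENNReal.ofReal_tsum_of_nonneg (fun _ ↦ by positivity) h.summable]
    refine tsum_congr fun k ↦ ?_
    rw [ENNReal.ofReal_pow (norm_nonneg _), ofReal_norm]
  have h2 : l2Norm φ ^ 2 = ∫⁻ x, ‖φ x‖ₑ ^ 2 := by
    rw [l2Norm, eLpNorm_eq_lintegral_rpow_enorm_toReal two_ne_zero ENNReal.ofNat_ne_top]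
    simp only [ENNReal.toReal_ofNat, sq_rpow_half, ENNReal.rpow_two]
  have h3 : ∫ x, ‖hφ'.toLp φ x‖ ^ 2 ∂AddCircle.haarAddCircle =
      ∫ x, ‖φ x‖ ^ 2 ∂AddCircle.haarAddCircle :=
    integral_congr_ae (hae.fun_comp fun z ↦ ‖z‖ ^ 2)
  rw [h1, h.tsum_eq, h2, AddCircle.volume_eq_smul_haarAddCircle, lintegral_smul_measure,
    smul_eq_mul, h3,
    ofReal_integral_eq_lintegral_ofReal]
  · congr 1
    refine lintegral_congr fun x ↦ ?_
    rw [ENNReal.ofReal_pow (norm_nonneg _), ofReal_norm]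
  · exact (memLp_two_iff_integrable_sq_norm hφ'.1).1 hφ'
  · exact ae_of_all _ fun x ↦ by simp only [Pi.zero_apply]; positivity

theorem tsum_enorm_fourierCoeff_sq_le {φ : Torus → ℂ} (hφ : MemLp φ 2 volume) :
    ∑' k, ‖fourierCoeff φ k‖ₑ ^ 2 ≤ l2Norm φ ^ 2 := by
  rw [← tsum_enorm_fourierCoeff_sq hφ]
  refine le_mul_of_one_le_left zero_le ?_
  rw [ENNReal.one_le_ofReal]
  linarith [Real.pi_gt_three]

/-! ### Lower bounds for the denominators -/

/-- Write Q = m² + n² + mn and r = 3β/(5α). The distance |r - Q| is at least some d > 0 by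
discreteness of ℤ, and at least Q - |r|. Weighting these bounds by |r| and d gives dQ ≤ (d + |r|)|r
- Q|, and m² + n² ≤ 2Q. -/
theorem exists_denom_lower_bound {α β : ℝ} (hα : α ≠ 0) (h : NonResonant α β) :
    ∃ c : ℝ, 0 < c ∧ ∀ m n : ℤ, m ≠ 0 → n ≠ 0 →
      c * ((m : ℝ) ^ 2 + (n : ℝ) ^ 2) ≤ |denom α β m n| := by
  set r : ℝ := 3 * β / (5 * α) with hr
  obtain ⟨d, hd, hdist⟩ : ∃ d : ℝ, 0 < d ∧ ∀ q : ℤ, (q : ℝ) ≠ r → d ≤ |r - q| := by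
    -- If r is an integer, every other integer is at distance at least 1; otherwise the nearest
    -- integer gives the distance.
    by_cases hint : r = round r
    · refine ⟨1, one_pos, fun q hq ↦ ?_⟩
      rw [hint] at hq ⊢
      have : round r - q ≠ 0 := fun h0 ↦ hq (by rw [sub_eq_zero.1 h0])
      exact_mod_cast Int.one_le_abs this
    · exact ⟨|r - round r|, abs_pos.2 (sub_ne_zero.2 hint), fun q _ ↦ round_le r q⟩
  refine ⟨5 * |α| * (d / (d + |r|)) / 2, by positivity, fun m n hm hn ↦ ?_⟩
  have hq := hdist (m ^ 2 + n ^ 2 + m * n) (by push_cast; exact fun h0 ↦ h m n hm hn h0.symm)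
  push_cast at hq
  set Q : ℝ := (m : ℝ) ^ 2 + (n : ℝ) ^ 2 + (m : ℝ) * n
  have hQ : ((m : ℝ) ^ 2 + (n : ℝ) ^ 2) / 2 ≤ Q := by
    simp only [Q]; nlinarith [sq_nonneg ((m : ℝ) + n)]
  have hden : denom α β m n = 5 * α * (Q - r) := by
    rw [denom, hr]; field_simp; ring
  have hx : Q - |r| ≤ |r - Q| := by
    have := neg_le_abs (r - Q)
    have := le_abs_self r
    linarith
  have hfrac : d / (d + |r|) * Q ≤ |r - Q| := by
    rw [div_mul_eq_mul_div, div_le_iff₀ (by positivity)]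
    nlinarith [mul_le_mul_of_nonneg_left hq (abs_nonneg r), mul_le_mul_of_nonneg_left hx hd.le]
  rw [hden, abs_mul, abs_mul, abs_sub_comm, abs_of_pos (by norm_num : (0 : ℝ) < 5)]
  calc 5 * |α| * (d / (d + |r|)) / 2 * ((m : ℝ) ^ 2 + (n : ℝ) ^ 2)
      = 5 * |α| * (d / (d + |r|) * (((m : ℝ) ^ 2 + (n : ℝ) ^ 2) / 2)) := by ring
    _ ≤ 5 * |α| * (d / (d + |r|) * Q) := by gcongr
    _ ≤ _ := by gcongr

theorem one_le_bracket (x : ℝ) : 1 ≤ bracket x := by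
  simp [bracket]

theorem bracket_pos (x : ℝ) : 0 < bracket x := one_pos.trans_le (one_le_bracket x)

/-! ### Fixed-time estimates -/

theorem exists_le_ofReal_sq {K : ℝ≥0∞} (hK : K ≠ ⊤) :
    ∃ C : ℝ, 0 < C ∧ K ≤ ENNReal.ofReal C ^ 2 := by
  refine ⟨K.toReal + 1, by positivity, ?_⟩
  rw [← ENNReal.ofReal_pow (by positivity)]
  refine ENNReal.le_ofReal_iff_toReal_le hK (by positivity) |>.2 ?_
  nlinarith [ENNReal.toReal_nonneg (a := K)]

theorem summable_of_tsum_enorm_ne_top {ι E : Type*} [NormedAddCommGroup E] [CompleteSpace E]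
    {f : ι → E} (h : ∑' i, ‖f i‖ₑ ≠ ⊤) : Summable f := by
  refine Summable.of_norm ?_
  have : Summable fun i ↦ ‖f i‖₊ := ENNReal.tsum_coe_ne_top_iff_summable.1 h
  exact NNReal.summable_coe.2 this

theorem fin_sum_sq_le {n : ℕ} (f : Fin n → ℝ≥0∞) : (∑ i, f i) ^ 2 ≤ n * ∑ i, f i ^ 2 := by
  simpa [tsum_fintype] using tsum_mul_sq_le (fun _ : Fin n ↦ 1) f

theorem add_sq_le_two_mul (x y : ℝ≥0∞) : (x + y) ^ 2 ≤ 2 * (x ^ 2 + y ^ 2) := by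
  simpa [Fin.sum_univ_two] using fin_sum_sq_le ![x, y]

theorem enorm_div_ofReal (z : ℂ) (r : ℝ) :
    ‖z / (r : ℂ)‖ₑ = ENNReal.ofReal |r|⁻¹ * ‖z‖ₑ := by
  rw [div_eq_mul_inv, enorm_mul, ← Complex.ofReal_inv, ← ofReal_norm (Complex.ofReal _),
    Complex.norm_real, Real.norm_eq_abs, abs_inv, mul_comm]

/-- The bracket is at least 1, so the H^s norm increases with s and only the integer endpoint has to
be treated. -/
theorem hsNorm_le_of_sq_le {s : ℝ} {m : ℕ} (hs : s ≤ m) {c : ℤ → ℂ} {D : ℝ≥0∞}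
    (h : ∑' k : ℤ, (ENNReal.ofReal (bracket k ^ m) * ‖c k‖ₑ) ^ 2 ≤ D ^ 2) :
    hsNorm s c ≤ D := by
  rw [hsNorm, one_div, ENNReal.rpow_inv_le_iff (by norm_num), ENNReal.rpow_two]
  refine le_trans (ENNReal.tsum_le_tsum fun k ↦ ?_) h
  rw [mul_pow, ← ENNReal.ofReal_pow (by have := bracket_pos k; positivity)]
  gcongr
  rw [← pow_mul, ← Real.rpow_natCast]
  refine Real.rpow_le_rpow_of_exponent_le (one_le_bracket _) ?_
  push_cast
  linarith

theorem bracket_add_le {m n : ℤ} (hm : m ≠ 0) :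
    bracket ((m + n : ℤ) : ℝ) ≤ 2 * (|(m : ℝ)| + |(n : ℝ)|) := by
  have hm' : (1 : ℝ) ≤ |(m : ℝ)| := by exact_mod_cast Int.one_le_abs hm
  have := abs_add_le (m : ℝ) n
  have := abs_nonneg (n : ℝ)
  simp only [bracket, Int.cast_add]
  linarith

/-- The inclusion ℓ² ⊂ ℓ⁶: each term is at most the whole sum. -/
theorem tsum_pow_six_le (a : ℤ → ℝ≥0∞) : ∑' k, (a k ^ 3) ^ 2 ≤ (∑' k, a k ^ 2) ^ 3 := by
  calc ∑' k, (a k ^ 3) ^ 2 ≤ ∑' k, (∑' k, a k ^ 2) ^ 2 * a k ^ 2 := by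
        refine ENNReal.tsum_le_tsum fun k ↦ ?_
        calc (a k ^ 3) ^ 2 = (a k ^ 2) ^ 2 * a k ^ 2 := by ring
          _ ≤ _ := by gcongr; exact ENNReal.le_tsum (f := fun k ↦ a k ^ 2) k
    _ = _ := by rw [ENNReal.tsum_mul_left, ← pow_succ]

/-! ### Smoothing bounds for single summands -/

section Denominators

variable {α β c : ℝ} (hc : 0 < c) (hden : ∀ m n : ℤ, m ≠ 0 → n ≠ 0 →
  c * ((m : ℝ) ^ 2 + (n : ℝ) ^ 2) ≤ |denom α β m n|)
include hc hden

theorem bracket_cube_div_le {m n : ℤ} (hm : m ≠ 0) (hn : n ≠ 0) :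
    bracket ((m + n : ℤ) : ℝ) ^ 3 / |(m : ℝ) * (n : ℝ) * denom α β m n| ≤
      16 / c * (1 / |(m : ℝ)| + 1 / |(n : ℝ)|) := by
  have hx : 0 < |(m : ℝ)| := abs_pos.2 (by exact_mod_cast hm)
  have hy : 0 < |(n : ℝ)| := abs_pos.2 (by exact_mod_cast hn)
  have hd := hden m n hm hn
  have hb := bracket_add_le (n := n) hm
  have hb0 := bracket_pos ((m + n : ℤ) : ℝ)
  rw [abs_mul, abs_mul]
  rw [← sq_abs (m : ℝ), ← sq_abs (n : ℝ)] at hd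
  set x := |(m : ℝ)|
  set y := |(n : ℝ)|
  calc bracket ((m + n : ℤ) : ℝ) ^ 3 / (x * y * |denom α β m n|)
      ≤ (2 * (x + y)) ^ 3 / (x * y * (c * (x ^ 2 + y ^ 2))) := by gcongr
    _ ≤ 16 / c * (1 / x + 1 / y) := by
      rw [div_add_div _ _ hx.ne' hy.ne', div_mul_div_comm, div_le_div_iff₀ (by positivity)
        (by positivity)]
      have : (x + y) ^ 2 ≤ 2 * (x ^ 2 + y ^ 2) := by nlinarith [sq_nonneg (x - y)]
      calc (2 * (x + y)) ^ 3 * (c * (x * y)) = 8 * (x + y) * (c * (x * y)) * (x + y) ^ 2 := by ring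
        _ ≤ 8 * (x + y) * (c * (x * y)) * (2 * (x ^ 2 + y ^ 2)) := by gcongr
        _ = _ := by ring

theorem bracket_sq_div_le {m n : ℤ} (hm : m ≠ 0) (hn : n ≠ 0) :
    bracket ((m + n : ℤ) : ℝ) ^ 2 / |denom α β m n| ≤ 8 / c := by
  have hx : 0 < |(m : ℝ)| := abs_pos.2 (by exact_mod_cast hm)
  have hd := hden m n hm hn
  have hb := bracket_add_le (n := n) hm
  have hb0 := bracket_pos ((m + n : ℤ) : ℝ)
  rw [← sq_abs (m : ℝ), ← sq_abs (n : ℝ)] at hd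
  set x := |(m : ℝ)|
  set y := |(n : ℝ)|
  calc bracket ((m + n : ℤ) : ℝ) ^ 2 / |denom α β m n|
      ≤ (2 * (x + y)) ^ 2 / (c * (x ^ 2 + y ^ 2)) := by gcongr
    _ ≤ 8 / c := by
      rw [div_le_div_iff₀ (by positivity) (by positivity)]
      nlinarith [mul_nonneg hc.le (sq_nonneg (x - y))]

theorem bracket_cube_mul_enorm_bTerm_le (a b : ℤ → ℂ) (k j : ℤ) :
    ENNReal.ofReal (bracket k ^ 3) * ‖bTerm α β a b k j‖ₑ ≤
      ENNReal.ofReal (16 / c) * (invWeight j * ‖a j‖ₑ * ‖b (k - j)‖ₑ +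
        ‖a j‖ₑ * (invWeight (k - j) * ‖b (k - j)‖ₑ)) := by
  rw [bTerm]
  split_ifs with h
  · have h1 := bracket_cube_div_le hc hden h.1 h.2
    rw [add_sub_cancel] at h1
    have h2 := ENNReal.ofReal_le_ofReal h1
    rw [ENNReal.ofReal_mul (by positivity), ENNReal.ofReal_add (by positivity) (by positivity)] at h2
    rw [enorm_div_ofReal, enorm_mul]
    calc ENNReal.ofReal (bracket k ^ 3) *
          (ENNReal.ofReal |(j : ℝ) * ((k - j : ℤ) : ℝ) * denom α β j (k - j)|⁻¹ *
            (‖a j‖ₑ * ‖b (k - j)‖ₑ))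
        = ENNReal.ofReal (bracket k ^ 3 / |(j : ℝ) * ((k - j : ℤ) : ℝ) * denom α β j (k - j)|) *
          (‖a j‖ₑ * ‖b (k - j)‖ₑ) := by
          rw [div_eq_mul_inv, ENNReal.ofReal_mul (by have := bracket_pos k; positivity)]
          ring
      _ ≤ _ := mul_le_mul_left h2 _
      _ = _ := by simp only [invWeight]; ring
  · simp

theorem tsum_bTerm_le (a b : ℤ → ℂ) :
    ∑' k : ℤ, (ENNReal.ofReal (bracket k ^ 3) * ∑' j, ‖bTerm α β a b k j‖ₑ) ^ 2 ≤
      4 * ENNReal.ofReal (16 / c) ^ 2 * (∑' k, invWeight k ^ 2) *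
        (∑' k, ‖a k‖ₑ ^ 2) * ∑' k, ‖b k‖ₑ ^ 2 := by
  set A := fun k ↦ ‖a k‖ₑ
  set B := fun k ↦ ‖b k‖ₑ
  have h1 (k : ℤ) : (ENNReal.ofReal (bracket k ^ 3) * ∑' j, ‖bTerm α β a b k j‖ₑ) ^ 2 ≤
      ENNReal.ofReal (16 / c) ^ 2 * (2 * ((∑' j, (invWeight j * A j) * B (k - j)) ^ 2 +
        (∑' j, (invWeight j * B j) * A (k - j)) ^ 2)) := by
    -- The reflection j ↦ k - j moves the weight to the first factor, so the same Young inequality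
    -- applies with the roles of a and b exchanged.
    have h2 : ∑' j, (invWeight j * B j) * A (k - j) =
        ∑' j, A j * (invWeight (k - j) * B (k - j)) := by
      rw [← (Equiv.subLeft k).tsum_eq]
      refine tsum_congr fun j ↦ ?_
      simp only [Equiv.subLeft_apply, sub_sub_cancel]
      ring
    rw [← ENNReal.tsum_mul_left, h2]
    calc _ ≤ (∑' j, ENNReal.ofReal (16 / c) * (invWeight j * A j * B (k - j) +
            A j * (invWeight (k - j) * B (k - j)))) ^ 2 := by
          exact pow_le_pow_left' (ENNReal.tsum_le_tsum fun j ↦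
            bracket_cube_mul_enorm_bTerm_le hc hden a b k j) 2
      _ ≤ _ := by
          rw [ENNReal.tsum_mul_left, mul_pow, ENNReal.tsum_add]
          gcongr
          exact add_sq_le_two_mul _ _
  calc _ ≤ _ := ENNReal.tsum_le_tsum h1
    _ ≤ ENNReal.ofReal (16 / c) ^ 2 * (2 * (
        (∑' k, invWeight k ^ 2) * (∑' k, A k ^ 2) * ∑' k, B k ^ 2 +
        (∑' k, invWeight k ^ 2) * (∑' k, B k ^ 2) * ∑' k, A k ^ 2)) := by
      rw [ENNReal.tsum_mul_left, ENNReal.tsum_mul_left, ENNReal.tsum_add]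
      gcongr
      · exact (tsum_tsum_mul_sq_le _ _).trans (mul_le_mul_left (tsum_invWeight_mul_sq_le _) _)
      · exact (tsum_tsum_mul_sq_le _ _).trans (mul_le_mul_left (tsum_invWeight_mul_sq_le _) _)
    _ = _ := by ring

theorem bracket_cube_mul_enorm_rhoCoeff_le (u : ℤ → ℂ) (k : ℤ) :
    ENNReal.ofReal (bracket k ^ 3) * ‖rhoCoeff α β u k‖ₑ ≤
      ENNReal.ofReal (2 / c) * ‖u k‖ₑ ^ 3 := by
  rw [rhoCoeff]
  split_ifs with h
  · simp
  · have hk : (0 : ℝ) < |(k : ℝ)| := abs_pos.2 (by exact_mod_cast h)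
    have hb := bracket_add_le (n := 0) h
    have hb0 := bracket_pos k
    simp only [add_zero, Int.cast_zero, abs_zero] at hb
    have hd := hden k k h h
    -- The denominator of ρ is the diagonal value m = n = k of the general factor, so the same lower
    -- bound applies.
    have hdk : 15 * α * (k : ℝ) ^ 2 - 3 * β = denom α β k k := by rw [denom]; ring
    rw [← sq_abs (k : ℝ)] at hd
    have key : bracket k ^ 3 * (‖u k‖ ^ 3 / |2 * denom α β k k * (k : ℝ)|) ≤ 2 / c * ‖u k‖ ^ 3 := by
      rw [abs_mul, abs_mul, abs_of_pos (by norm_num : (0 : ℝ) < 2)]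
      calc _ ≤ (2 * |(k : ℝ)|) ^ 3 * (‖u k‖ ^ 3 /
              (2 * (c * (|(k : ℝ)| ^ 2 + |(k : ℝ)| ^ 2)) * |(k : ℝ)|)) := by gcongr
        _ = _ := by field_simp; ring
    have := ENNReal.ofReal_le_ofReal key
    rw [ENNReal.ofReal_mul (by positivity), ENNReal.ofReal_mul (by positivity),
      ENNReal.ofReal_pow (norm_nonneg _), ofReal_norm] at this
    refine le_trans (le_of_eq ?_) this
    rw [hdk, ← ofReal_norm, norm_div, norm_mul, norm_mul, Complex.norm_I, Complex.norm_real,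
      Complex.norm_real, Real.norm_eq_abs, Real.norm_eq_abs, one_mul,
      abs_of_nonneg (by positivity), ← pow_succ]

theorem bracket_sq_mul_enorm_sigmaTerm_le (u : ℤ → ℂ) {k : ℤ} (hk : k ≠ 0) (j : ℤ) :
    ENNReal.ofReal (bracket k ^ 2) * ‖sigmaTerm α β u k j‖ₑ ≤
      ENNReal.ofReal (4 / c) * ‖u j‖ₑ ^ 2 := by
  rw [sigmaTerm]
  split_ifs with h
  · have hk' : (0 : ℝ) < |(k : ℝ)| := abs_pos.2 (by exact_mod_cast hk)
    have hj : (1 : ℝ) ≤ |(j : ℝ)| := by exact_mod_cast Int.one_le_abs h.1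
    have hb := bracket_add_le (n := 0) hk
    have hb0 := bracket_pos k
    simp only [add_zero, Int.cast_zero, abs_zero] at hb
    -- The quadratic form in σ has the opposite cross term, hence the frequency -j.
    have hd := hden k (-j) hk (neg_ne_zero.2 h.1)
    have hdk : 5 * α * ((k : ℝ) ^ 2 - (k : ℝ) * (j : ℝ) + (j : ℝ) ^ 2) - 3 * β =
        denom α β k (-j) := by rw [denom]; push_cast; ring
    have hd' : c * |(k : ℝ)| ^ 2 ≤ |denom α β k (-j)| := by
      rw [sq_abs]
      refine le_trans ?_ hd
      gcongr
      exact le_add_of_nonneg_right (sq_nonneg _)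
    have key : bracket k ^ 2 * (‖u j‖ ^ 2 / |(j : ℝ) * denom α β k (-j)|) ≤ 4 / c * ‖u j‖ ^ 2 := by
      rw [abs_mul]
      calc _ ≤ (2 * |(k : ℝ)|) ^ 2 * (‖u j‖ ^ 2 / (1 * (c * |(k : ℝ)| ^ 2))) := by gcongr
        _ = _ := by field_simp; ring
    have := ENNReal.ofReal_le_ofReal key
    rw [ENNReal.ofReal_mul (by positivity), ENNReal.ofReal_mul (by positivity),
      ENNReal.ofReal_pow (norm_nonneg _), ofReal_norm] at this
    refine le_trans (le_of_eq ?_) this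
    rw [hdk, ← ofReal_norm (_ / _), norm_div, Real.norm_eq_abs, Real.norm_eq_abs,
      abs_of_nonneg (by positivity)]
  · simp

/-- The smoothing factor of `R`, applied to each summand. -/
theorem bracket_sq_mul_enorm_cubicTerm_le (u : ℤ → ℂ) (k₁ k₂ k₃ : ℤ) :
    ENNReal.ofReal (bracket ((k₁ + k₂ + k₃ : ℤ) : ℝ) ^ 2) * ‖cubicTerm α β u k₁ k₂ k₃‖ₑ ≤
      ENNReal.ofReal (8 / c) * (invWeight k₁ * (‖u k₁‖ₑ * (‖u k₂‖ₑ * ‖u k₃‖ₑ))) := by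
  rw [cubicTerm]
  split_ifs with h
  · have h23 : k₂ + k₃ ≠ 0 := right_ne_zero_of_mul (left_ne_zero_of_mul h.2)
    have h1 := bracket_sq_div_le hc hden h.1 h23
    rw [← add_assoc] at h1
    have h2 := ENNReal.ofReal_le_ofReal h1
    rw [enorm_div_ofReal, enorm_mul, enorm_mul, invWeight, abs_mul, mul_inv, one_div,
      ENNReal.ofReal_mul (by positivity)]
    rw [div_eq_mul_inv, ENNReal.ofReal_mul (by positivity)] at h2
    calc _ = ENNReal.ofReal (bracket ((k₁ + k₂ + k₃ : ℤ) : ℝ) ^ 2) *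
          ENNReal.ofReal |denom α β k₁ (k₂ + k₃)|⁻¹ *
          (ENNReal.ofReal |(k₁ : ℝ)|⁻¹ * (‖u k₁‖ₑ * (‖u k₂‖ₑ * ‖u k₃‖ₑ))) := by ring
      _ ≤ _ := mul_le_mul_left h2 _
  · simp

end Denominators

/-! ### Estimates for B, ρ, σ and convergence of R at fixed time -/

theorem bCoeff_estimate {α β : ℝ} (hα : α ≠ 0) (hnr : NonResonant α β) :
    ∃ C : ℝ, 0 < C ∧ ∀ s : ℝ, s ≤ 3 → ∀ φ ψ : Torus → ℂ, IsDotL2 φ → IsDotL2 ψ →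
      (∀ k : ℤ, k ≠ 0 → Summable (bTerm α β (fourierCoeff φ) (fourierCoeff ψ) k)) ∧
      hsNorm s (bCoeff α β (fourierCoeff φ) (fourierCoeff ψ)) ≤
        ENNReal.ofReal C * l2Norm φ * l2Norm ψ := by
  obtain ⟨c, hc, hden⟩ := exists_denom_lower_bound hα hnr
  obtain ⟨C, hC, hKC⟩ := exists_le_ofReal_sq
    (K := 4 * ENNReal.ofReal (16 / c) ^ 2 * ∑' k, invWeight k ^ 2)
    (by finiteness [tsum_invWeight_sq_ne_top])
  refine ⟨C, hC, fun s hs φ ψ hφ hψ ↦ ?_⟩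
  -- Bounding the sum of absolute values yields both claims: finiteness gives absolute convergence,
  -- and the triangle inequality gives the norm bound.
  have key : ∑' k : ℤ, (ENNReal.ofReal (bracket k ^ 3) *
      ∑' j, ‖bTerm α β (fourierCoeff φ) (fourierCoeff ψ) k j‖ₑ) ^ 2 ≤
      (ENNReal.ofReal C * l2Norm φ * l2Norm ψ) ^ 2 := by
    refine (tsum_bTerm_le hc hden _ _).trans ?_
    rw [mul_pow, mul_pow]
    gcongr
    · exact tsum_enorm_fourierCoeff_sq_le hφ.1
    · exact tsum_enorm_fourierCoeff_sq_le hψ.1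
  constructor
  · intro k _
    apply summable_of_tsum_enorm_ne_top
    intro htop
    have h1 := (ENNReal.le_tsum k).trans key
    have hb : ENNReal.ofReal (bracket k ^ 3) ≠ 0 := by
      have := bracket_pos k
      simp only [ne_eq, ENNReal.ofReal_eq_zero, not_le]
      positivity
    rw [htop, ENNReal.mul_top hb, ENNReal.top_pow two_ne_zero, top_le_iff] at h1
    exact absurd h1 (by finiteness [hφ.1.2.ne, hψ.1.2.ne])
  · refine hsNorm_le_of_sq_le (m := 3) (by exact_mod_cast hs) (le_trans ?_ key)
    gcongr with k
    rw [bCoeff]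
    split_ifs
    · simp
    · rw [enorm_mul]
      have h1 : ‖(-(1 / 2) : ℂ)‖ₑ ≤ 1 := by
        rw [← ofReal_norm]
        simp
      calc _ ≤ 1 * ∑' j, ‖bTerm α β (fourierCoeff φ) (fourierCoeff ψ) k j‖ₑ := by
            gcongr; exact enorm_tsum_le_tsum_enorm
        _ = _ := one_mul _

theorem rhoCoeff_estimate {α β : ℝ} (hα : α ≠ 0) (hnr : NonResonant α β) :
    ∃ C : ℝ, 0 < C ∧ ∀ s : ℝ, s ≤ 3 → ∀ u : Torus → ℂ, IsDotL2 u →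
      hsNorm s (rhoCoeff α β (fourierCoeff u)) ≤ ENNReal.ofReal C * l2Norm u ^ 3 := by
  obtain ⟨c, hc, hden⟩ := exists_denom_lower_bound hα hnr
  refine ⟨2 / c, by positivity, fun s hs u hu ↦ ?_⟩
  refine hsNorm_le_of_sq_le (m := 3) (by exact_mod_cast hs) ?_
  calc _ ≤ ∑' k, (ENNReal.ofReal (2 / c) * ‖fourierCoeff u k‖ₑ ^ 3) ^ 2 :=
        ENNReal.tsum_le_tsum fun k ↦
          pow_le_pow_left' (bracket_cube_mul_enorm_rhoCoeff_le hc hden _ k) 2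
    _ ≤ ENNReal.ofReal (2 / c) ^ 2 * (l2Norm u ^ 2) ^ 3 := by
      simp_rw [mul_pow (ENNReal.ofReal _)]
      rw [ENNReal.tsum_mul_left]
      gcongr
      refine (tsum_pow_six_le _).trans ?_
      gcongr
      exact tsum_enorm_fourierCoeff_sq_le hu.1
    _ = _ := by ring

theorem sigmaCoeff_estimate {α β : ℝ} (hα : α ≠ 0) (hnr : NonResonant α β) :
    ∃ C : ℝ, 0 < C ∧ ∀ s : ℝ, s ≤ 2 → ∀ u : Torus → ℂ, IsDotL2 u →
      (∀ k : ℤ, k ≠ 0 → Summable (sigmaTerm α β (fourierCoeff u) k)) ∧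
      hsNorm s (sigmaCoeff α β (fourierCoeff u)) ≤ ENNReal.ofReal C * l2Norm u ^ 3 := by
  obtain ⟨c, hc, hden⟩ := exists_denom_lower_bound hα hnr
  refine ⟨4 / c, by positivity, fun s hs u hu ↦ ?_⟩
  have key {k : ℤ} (hk : k ≠ 0) : ENNReal.ofReal (bracket k ^ 2) *
      ∑' j, ‖sigmaTerm α β (fourierCoeff u) k j‖ₑ ≤ ENNReal.ofReal (4 / c) * l2Norm u ^ 2 := by
    rw [← ENNReal.tsum_mul_left]
    refine (ENNReal.tsum_le_tsum fun j ↦ bracket_sq_mul_enorm_sigmaTerm_le hc hden _ hk j).trans ?_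
    rw [ENNReal.tsum_mul_left]
    gcongr
    exact tsum_enorm_fourierCoeff_sq_le hu.1
  constructor
  · intro k hk
    apply summable_of_tsum_enorm_ne_top
    intro htop
    have h1 := key hk
    have hb : ENNReal.ofReal (bracket k ^ 2) ≠ 0 := by
      have := bracket_pos k
      simp only [ne_eq, ENNReal.ofReal_eq_zero, not_le]
      positivity
    rw [htop, ENNReal.mul_top hb, top_le_iff] at h1
    exact absurd h1 (by finiteness [hu.1.2.ne])
  · refine hsNorm_le_of_sq_le (m := 2) (by exact_mod_cast hs) ?_
    calc _ ≤ ∑' k, ((ENNReal.ofReal (4 / c) * l2Norm u ^ 2) * ‖fourierCoeff u k‖ₑ) ^ 2 := by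
          refine ENNReal.tsum_le_tsum fun k ↦ pow_le_pow_left' ?_ 2
          rw [sigmaCoeff]
          split_ifs with hk
          · simp
          · have h1 : ‖-Complex.I‖ₑ = 1 := by rw [← ofReal_norm]; simp
            have h2 : ‖((∑' j, sigmaTerm α β (fourierCoeff u) k j : ℝ) : ℂ)‖ₑ ≤
                ∑' j, ‖sigmaTerm α β (fourierCoeff u) k j‖ₑ := by
              rw [← ofReal_norm, Complex.norm_real, ofReal_norm]
              exact enorm_tsum_le_tsum_enorm
            rw [enorm_mul, enorm_mul, h1, one_mul, mul_left_comm, mul_comm]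
            exact mul_le_mul_left ((mul_le_mul_right h2 _).trans (key hk)) _
      _ ≤ (ENNReal.ofReal (4 / c) * l2Norm u ^ 2) ^ 2 * l2Norm u ^ 2 := by
          simp_rw [mul_pow _ (‖fourierCoeff u _‖ₑ)]
          rw [ENNReal.tsum_mul_left]
          gcongr
          exact tsum_enorm_fourierCoeff_sq_le hu.1
      _ = _ := by ring

theorem summable_rTerm {α β : ℝ} (hα : α ≠ 0) (hnr : NonResonant α β) {u : Torus → ℂ}
    (hu : MemLp u 2 volume) (k : ℤ) : Summable (rTerm α β (fourierCoeff u) k) := by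
  obtain ⟨c, hc, hden⟩ := exists_denom_lower_bound hα hnr
  apply summable_of_tsum_enorm_ne_top
  have h1 (p : ℤ × ℤ) : ‖rTerm α β (fourierCoeff u) k p‖ₑ ≤ ENNReal.ofReal (8 / c) *
      (invWeight p.1 * (‖fourierCoeff u p.1‖ₑ *
        (‖fourierCoeff u p.2‖ₑ * ‖fourierCoeff u (k - p.1 - p.2)‖ₑ))) := by
    refine le_trans ?_ (bracket_sq_mul_enorm_cubicTerm_le hc hden _ _ _ _)
    refine le_mul_of_one_le_left zero_le ?_
    rw [ENNReal.one_le_ofReal]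
    exact one_le_pow₀ (one_le_bracket _)
  refine ne_top_of_le_ne_top ?_ (ENNReal.tsum_le_tsum h1)
  rw [ENNReal.tsum_mul_left]
  refine ENNReal.mul_ne_top ENNReal.ofReal_ne_top ?_
  have h2 := tsum_invWeight_mul_three_sq_le (fun k ↦ ‖fourierCoeff u k‖ₑ) k
  have h3 : ∑' k, ‖fourierCoeff u k‖ₑ ^ 2 ≠ ⊤ :=
    ne_top_of_le_ne_top (by finiteness [hu.2.ne]) (tsum_enorm_fourierCoeff_sq_le hu)
  intro htop
  rw [htop, ENNReal.top_pow two_ne_zero, top_le_iff] at h2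
  exact absurd h2 (ENNReal.mul_ne_top tsum_invWeight_sq_ne_top (ENNReal.pow_ne_top h3))

/-! ### The Fourier transform of square integrable functions -/

section Plancherel

open FourierTransform

/-- Fubini, since the kernel is symmetric in its two variables. -/
theorem integral_fourierInv_mul_of_integrable {f g : ℝ → ℂ} (hf : Integrable f)
    (hg : Integrable g) : ∫ ξ, 𝓕⁻ f ξ * g ξ = ∫ x, f x * 𝓕⁻ g x := by
  have h := VectorFourier.integral_fourierIntegral_smul_eq_flip (μ := volume) (ν := volume)
    (L := -innerₗ ℝ) Real.continuous_fourierChar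
    (by simp only [LinearMap.neg_apply, innerₗ_apply_apply]; fun_prop) hf hg
  have hflip : (-innerₗ ℝ).flip = -innerₗ ℝ := by
    ext; simp
  rw [hflip] at h
  exact h

theorem continuous_fourierInv_of_integrable {f : ℝ → ℂ} (hf : Integrable f) :
    Continuous (𝓕⁻ f) :=
  VectorFourier.fourierIntegral_continuous (L := -innerₗ ℝ) Real.continuous_fourierChar
    (by simp only [LinearMap.neg_apply, innerₗ_apply_apply]; fun_prop) hf

theorem exists_schwartzMap_of_test {g : ℝ → ℝ} (hg : ContDiff ℝ ∞ g) (hg' : HasCompactSupport g) :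
    ∃ ψ : SchwartzMap ℝ ℂ, ∀ x, ψ x = (g x : ℂ) :=
  ⟨HasCompactSupport.toSchwartzMap (f := fun x ↦ (g x : ℂ)) (hg'.comp_left Complex.ofReal_zero)
    (Complex.ofRealCLM.contDiff.comp hg), fun _ ↦ rfl⟩

theorem ae_eq_of_integral_schwartzMap_eq {f f' : ℝ → ℂ} (hf : LocallyIntegrable f)
    (hf' : LocallyIntegrable f')
    (h : ∀ ψ : SchwartzMap ℝ ℂ, ∫ x, ψ x * f x = ∫ x, ψ x * f' x) : f =ᵐ[volume] f' := by
  refine ae_eq_of_integral_contDiff_smul_eq hf hf' fun g hg hg' ↦ ?_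
  obtain ⟨ψ, hψ⟩ := exists_schwartzMap_of_test hg hg'
  simpa only [hψ, Complex.real_smul] using h ψ

theorem integral_schwartzMap_mul_fourierInv (F : Lp ℂ 2 (volume : Measure ℝ))
    (ψ : SchwartzMap ℝ ℂ) :
    ∫ x, ψ x * (𝓕⁻ F : Lp ℂ 2 (volume : Measure ℝ)) x = ∫ x, 𝓕⁻ (ψ : ℝ → ℂ) x * F x := by
  have h := congrArg (fun T ↦ T ψ) (Lp.fourierInv_toTemperedDistribution_eq F)
  simp only [TemperedDistribution.fourierInv_apply, Lp.toTemperedDistribution_apply,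
    smul_eq_mul, SchwartzMap.fourierInv_coe] at h
  exact h.symm

theorem integral_schwartzMap_mul_fourier (F : Lp ℂ 2 (volume : Measure ℝ))
    (ψ : SchwartzMap ℝ ℂ) :
    ∫ x, ψ x * (𝓕 F : Lp ℂ 2 (volume : Measure ℝ)) x = ∫ x, (𝓕 ψ) x * F x := by
  have h := congrArg (fun T ↦ T ψ) (Lp.fourier_toTemperedDistribution_eq F)
  simp only [TemperedDistribution.fourier_apply, Lp.toTemperedDistribution_apply,
    smul_eq_mul] at h
  exact h.symm

theorem locallyIntegrable_Lp_two (F : Lp ℂ 2 (volume : Measure ℝ)) : LocallyIntegrable F :=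
  (Lp.memLp F).locallyIntegrable one_le_two

theorem fourierInv_toLp_ae_eq {f : ℝ → ℂ} (hf : Integrable f) (hf2 : MemLp f 2) :
    (𝓕⁻ (hf2.toLp f) : Lp ℂ 2 (volume : Measure ℝ)) =ᵐ[volume] 𝓕⁻ f := by
  refine ae_eq_of_integral_schwartzMap_eq (locallyIntegrable_Lp_two _)
    (continuous_fourierInv_of_integrable hf).locallyIntegrable fun ψ ↦ ?_
  rw [integral_schwartzMap_mul_fourierInv, ← integral_fourierInv_mul_of_integrable ψ.integrable hf]
  refine integral_congr_ae ?_
  filter_upwards [hf2.coeFn_toLp] with x hx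
  rw [hx]

theorem memLp_fourierInv {f : ℝ → ℂ} (hf : Integrable f) (hf2 : MemLp f 2) :
    MemLp (𝓕⁻ f) 2 :=
  (memLp_congr_ae (fourierInv_toLp_ae_eq hf hf2)).1 (Lp.memLp _)

theorem exists_clm_integral_mul {g : ℝ → ℂ} (hg : MemLp g 2) :
    ∃ B : Lp ℂ 2 (volume : Measure ℝ) →L[ℂ] ℂ, ∀ F, B F = ∫ x, F x * g x := by
  refine ⟨(ContinuousLinearMap.lpPairing (volume : Measure ℝ) 2 2
    (ContinuousLinearMap.mul ℂ ℂ)).flip (hg.toLp g), fun F ↦ ?_⟩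
  rw [ContinuousLinearMap.flip_apply, ContinuousLinearMap.lpPairing_eq_integral]
  refine integral_congr_ae ?_
  filter_upwards [hg.coeFn_toLp] with x hx
  rw [hx]; rfl

/-- Both sides are continuous in F for the L² norm, by Plancherel, and agree on the dense set of
Schwartz functions. -/
theorem integral_mul_fourierInv (F : Lp ℂ 2 (volume : Measure ℝ)) {f : ℝ → ℂ}
    (hf : Integrable f) (hf2 : MemLp f 2) :
    ∫ x, F x * 𝓕⁻ f x = ∫ x, (𝓕⁻ F : Lp ℂ 2 (volume : Measure ℝ)) x * f x := by
  obtain ⟨B₁, h1⟩ := exists_clm_integral_mul (memLp_fourierInv hf hf2)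
  obtain ⟨B₂, h2⟩ := exists_clm_integral_mul hf2
  have c1 : Continuous fun F ↦ B₁ F := B₁.continuous
  have c2 : Continuous fun F : Lp ℂ 2 (volume : Measure ℝ) ↦ B₂ (𝓕⁻ F) :=
    B₂.continuous.comp (Lp.fourierTransformₗᵢ ℝ ℂ).symm.continuous
  rw [← h1, ← h2]
  refine (SchwartzMap.denseRange_toLpCLM (F := ℂ) (E := ℝ) (p := 2) (μ := volume)
      ENNReal.ofNat_ne_top).induction_on (p := fun F ↦ B₁ F = B₂ (𝓕⁻ F)) F
      (isClosed_eq c1 c2) fun ψ ↦ ?_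
  · change B₁ (ψ.toLp 2) = B₂ (𝓕⁻ (ψ.toLp 2))
    rw [SchwartzMap.toLp_fourierInv_eq, h1, h2]
    have e1 : ∫ x, (ψ.toLp 2) x * 𝓕⁻ f x = ∫ x, ψ x * 𝓕⁻ f x := by
      refine integral_congr_ae ?_
      filter_upwards [ψ.coeFn_toLp 2] with x hx
      rw [hx]
    have e2 : ∫ x, ((𝓕⁻ ψ).toLp 2) x * f x = ∫ x, 𝓕⁻ (ψ : ℝ → ℂ) x * f x := by
      refine integral_congr_ae ?_
      filter_upwards [(𝓕⁻ ψ).coeFn_toLp 2] with x hx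
      rw [hx, SchwartzMap.fourierInv_coe]
    rw [e1, e2, integral_fourierInv_mul_of_integrable ψ.integrable hf]

/-- An integrable function whose Fourier transform is square integrable is square integrable. -/
theorem eLpNorm_eq_of_memLp_fourierInv {f : ℝ → ℂ} (hf : Integrable f)
    (hf2 : MemLp (𝓕⁻ f) 2) : eLpNorm f 2 = eLpNorm (𝓕⁻ f) 2 := by
  have h : (𝓕 (hf2.toLp _) : Lp ℂ 2 (volume : Measure ℝ)) =ᵐ[volume] f := by
    refine ae_eq_of_integral_schwartzMap_eq (locallyIntegrable_Lp_two _)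
      hf.locallyIntegrable fun ψ ↦ ?_
    rw [integral_schwartzMap_mul_fourier]
    calc ∫ x, (𝓕 ψ) x * (hf2.toLp _) x = ∫ x, (𝓕 ψ) x * 𝓕⁻ f x := by
          refine integral_congr_ae ?_
          filter_upwards [hf2.coeFn_toLp] with x hx
          rw [hx]
      _ = ∫ x, 𝓕⁻ ((𝓕 ψ : SchwartzMap ℝ ℂ) : ℝ → ℂ) x * f x :=
          (integral_fourierInv_mul_of_integrable (𝓕 ψ).integrable hf).symm
      _ = _ := by rw [← SchwartzMap.fourierInv_coe, fourierInv_fourier_eq]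
  rw [← eLpNorm_congr_ae h, ← eLpNorm_congr_ae hf2.coeFn_toLp]
  have h2 := congrArg ENNReal.ofReal (Lp.norm_fourier_eq (hf2.toLp _))
  simpa only [Lp.norm_def, ENNReal.ofReal_toReal (Lp.eLpNorm_ne_top _)] using h2

end Plancherel

/-! ### The transform with kernel e^{iτt} on L² -/

theorem lintegral_comp_mul_left' {c : ℝ} (hc : 0 < c) (g : ℝ → ℝ≥0∞) :
    ENNReal.ofReal c * ∫⁻ x, g (c * x) = ∫⁻ x, g x := by
  have h := lintegral_map_equiv (μ := volume) g (Homeomorph.mulLeft₀ c hc.ne').toMeasurableEquiv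
  have h2 : Measure.map (Homeomorph.mulLeft₀ c hc.ne').toMeasurableEquiv volume =
    ENNReal.ofReal |c⁻¹| • volume := Real.map_volume_mul_left hc.ne'
  rw [h2, lintegral_smul_measure, smul_eq_mul] at h
  have h3 : ∫⁻ x, g (c * x) = ENNReal.ofReal |c⁻¹| * ∫⁻ x, g x := h.symm
  rw [h3, ← mul_assoc, ← ENNReal.ofReal_mul hc.le, abs_of_pos (by positivity),
    mul_inv_cancel₀ hc.ne', ENNReal.ofReal_one, one_mul]

theorem eLpNorm_two_sq {X E : Type*} [MeasurableSpace X] [NormedAddCommGroup E] (μ : Measure X)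
    (f : X → E) : eLpNorm f 2 μ ^ 2 = ∫⁻ x, ‖f x‖ₑ ^ 2 ∂μ := by
  rw [eLpNorm_eq_lintegral_rpow_enorm_toReal two_ne_zero ENNReal.ofNat_ne_top]
  simp only [ENNReal.toReal_ofNat, sq_rpow_half, ENNReal.rpow_two]

theorem memLp_two_of_lintegral {X E : Type*} [MeasurableSpace X] [NormedAddCommGroup E]
    {μ : Measure X} {f : X → E} (hf : AEStronglyMeasurable f μ)
    (h : ∫⁻ x, ‖f x‖ₑ ^ 2 ∂μ ≠ ⊤) : MemLp f 2 μ := by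
  refine ⟨hf, lt_top_iff_ne_top.2 fun h' ↦ h ?_⟩
  rw [← eLpNorm_two_sq, h', ENNReal.top_pow two_ne_zero]

/-- The oscillatory integral `∫ e^{iτt} φ(t) dt`. -/
noncomputable def oscIntegral (φ : ℝ → ℂ) (τ : ℝ) : ℂ :=
  ∫ t : ℝ, Complex.exp (Complex.I * (τ : ℂ) * (t : ℂ)) * φ t

theorem oscIntegral_eq_fourierInv (φ : ℝ → ℂ) (w : ℝ) :
    oscIntegral φ (2 * Real.pi * w) = FourierTransformInv.fourierInv φ w := by
  rw [Real.fourierInv_eq']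
  refine integral_congr_ae (ae_of_all _ fun t ↦ ?_)
  simp only [smul_eq_mul, RCLike.inner_apply, conj_trivial]
  congr 2
  push_cast
  ring

theorem continuous_oscIntegral {φ : ℝ → ℂ} (hφ : Integrable φ) : Continuous (oscIntegral φ) := by
  have h : oscIntegral φ = fun τ ↦ FourierTransformInv.fourierInv φ ((2 * Real.pi)⁻¹ * τ) := by
    ext τ
    rw [← oscIntegral_eq_fourierInv, mul_inv_cancel_left₀ Real.two_pi_pos.ne']
  rw [h]
  exact (continuous_fourierInv_of_integrable hφ).comp (by fun_prop)

/-- This realises the distribution with transform G as an L² function. The change of variables τ =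
2πw passes to the kernel e^{2πiwt}, for which Plancherel holds without a constant. -/
theorem exists_dual_transform {G : ℝ → ℂ} (hG : MemLp G 2) :
    ∃ V : ℝ → ℂ, Measurable V ∧ MemLp V 2 ∧
      ∫⁻ t, ‖V t‖ₑ ^ 2 = ENNReal.ofReal (2 * Real.pi) * ∫⁻ τ, ‖G τ‖ₑ ^ 2 ∧
      ∀ φ : ℝ → ℂ, Integrable φ → MemLp φ 2 →
        ∫ τ, G τ * oscIntegral φ τ = ∫ t, V t * φ t := by
  have hpi := Real.two_pi_pos
  have hG' : MemLp (fun w ↦ G (2 * Real.pi * w)) 2 := by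
    refine memLp_two_of_lintegral ?_ ?_
    · refine hG.1.comp_quasiMeasurePreserving ⟨by fun_prop, ?_⟩
      rw [Real.map_volume_mul_left hpi.ne']
      exact Measure.smul_absolutelyContinuous
    · intro h
      have h2 := lintegral_comp_mul_left' hpi fun τ ↦ ‖G τ‖ₑ ^ 2
      rw [h, ENNReal.mul_top (by simpa using Real.pi_pos), ← eLpNorm_two_sq] at h2
      exact absurd h2.symm (by finiteness [hG.2.ne])
  set F := FourierTransformInv.fourierInv (hG'.toLp _) with hF
  have hFm := (Lp.stronglyMeasurable F).measurable
  -- The factor 2π is the Jacobian of τ = 2πw. In the squared norm it gives (2π)², and undoing the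
  -- scaling of G takes away one factor.
  refine ⟨fun t ↦ (2 * Real.pi : ℝ) * F t, by fun_prop, (Lp.memLp F).const_mul _, ?_, ?_⟩
  · have h1 : ∫⁻ t, ‖F t‖ₑ ^ 2 = ∫⁻ w, ‖G (2 * Real.pi * w)‖ₑ ^ 2 := by
      rw [← eLpNorm_two_sq, ← eLpNorm_two_sq volume (fun w ↦ G (2 * Real.pi * w)),
        ← eLpNorm_congr_ae hG'.coeFn_toLp, ← ENNReal.ofReal_toReal (Lp.eLpNorm_ne_top F),
        ← ENNReal.ofReal_toReal (Lp.eLpNorm_ne_top (hG'.toLp _)), ← Lp.norm_def, ← Lp.norm_def]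
      congr 2
      exact (Lp.fourierTransformₗᵢ ℝ ℂ).symm.norm_map _
    simp only [enorm_mul, mul_pow]
    rw [lintegral_const_mul _ (by fun_prop), h1,
      ← lintegral_comp_mul_left' hpi fun τ ↦ ‖G τ‖ₑ ^ 2, ← mul_assoc, ← ofReal_norm,
      Complex.norm_real, Real.norm_of_nonneg hpi.le, sq]
  · intro φ hφ hφ2
    calc ∫ τ, G τ * oscIntegral φ τ
        = (2 * Real.pi) • ∫ w, G (2 * Real.pi * w) * oscIntegral φ (2 * Real.pi * w) := by
          rw [Measure.integral_comp_mul_left (fun τ ↦ G τ * oscIntegral φ τ), smul_smul,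
            abs_of_pos (by positivity), mul_inv_cancel₀ hpi.ne', one_smul]
      _ = (2 * Real.pi) • ∫ w, (hG'.toLp _) w * FourierTransformInv.fourierInv φ w := by
          congr 1
          refine integral_congr_ae ?_
          filter_upwards [hG'.coeFn_toLp] with w hw
          rw [hw, oscIntegral_eq_fourierInv]
      _ = (2 * Real.pi) • ∫ t, F t * φ t := by rw [integral_mul_fourierInv _ hφ hφ2]
      _ = _ := by
          simp only [mul_assoc, integral_const_mul, Complex.real_smul]

/-- Plancherel for a function known only to be integrable; the constant 1/(2π) is bounded by 1. -/
theorem memLp_two_of_oscIntegral {f : ℝ → ℂ} (hf : Integrable f)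
    (h : ∫⁻ τ, ‖oscIntegral f τ‖ₑ ^ 2 ≠ ⊤) :
    MemLp f 2 ∧ ∫⁻ t, ‖f t‖ₑ ^ 2 ≤ ∫⁻ τ, ‖oscIntegral f τ‖ₑ ^ 2 := by
  have hpi := Real.two_pi_pos
  have h1 := lintegral_comp_mul_left' hpi fun τ ↦ ‖oscIntegral f τ‖ₑ ^ 2
  simp only [oscIntegral_eq_fourierInv] at h1
  have hle : ∫⁻ w, ‖FourierTransformInv.fourierInv f w‖ₑ ^ 2 ≤ ∫⁻ τ, ‖oscIntegral f τ‖ₑ ^ 2 := by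
    rw [← h1]
    refine le_mul_of_one_le_left zero_le ?_
    rw [ENNReal.one_le_ofReal]
    linarith [Real.pi_gt_three]
  have hm : MemLp (FourierTransformInv.fourierInv f) 2 :=
    memLp_two_of_lintegral (continuous_fourierInv_of_integrable hf).aestronglyMeasurable
      (ne_top_of_le_ne_top h hle)
  have heq := eLpNorm_eq_of_memLp_fourierInv hf hm
  refine ⟨⟨hf.1, heq ▸ hm.2⟩, ?_⟩
  rw [← eLpNorm_two_sq, heq, eLpNorm_two_sq]
  exact hle

/-! ### Weighted convolution estimates -/

theorem measurable_bracket : Measurable bracket := by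
  unfold bracket; fun_prop

/-- The decaying weight `⟨τ + p⟩^(-9/16)`. -/
noncomputable def decay (p τ : ℝ) : ℝ≥0∞ := ENNReal.ofReal (bracket (τ + p) ^ (-(9 / 16) : ℝ))

/-- The growing weight `⟨τ + p⟩^(1/2)`. -/
noncomputable def growth (p τ : ℝ) : ℝ≥0∞ := ENNReal.ofReal (bracket (τ + p) ^ (1 / 2 : ℝ))

/-- The squared norm `∫ ⟨τ + p⟩ f(τ)² dτ`. -/
noncomputable def weightedSq (p : ℝ) (f : ℝ → ℝ≥0∞) : ℝ≥0∞ :=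
  ∫⁻ τ, ENNReal.ofReal (bracket (τ + p)) * f τ ^ 2

/-- The total mass of the square of `decay`. -/
noncomputable def decayMass : ℝ≥0∞ := ∫⁻ τ, decay 0 τ ^ 2

theorem measurable_decay (p : ℝ) : Measurable (decay p) := by
  have := measurable_bracket
  unfold decay; fun_prop

theorem measurable_growth (p : ℝ) : Measurable (growth p) := by
  have := measurable_bracket
  unfold growth; fun_prop

theorem lintegral_decay_sq (p : ℝ) : ∫⁻ τ, decay p τ ^ 2 = decayMass := by
  have h := lintegral_add_right_eq_self (μ := (volume : Measure ℝ)) (fun τ ↦ decay 0 τ ^ 2) p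
  simpa only [decayMass, decay, add_zero] using h

/-- The exponent 9/16 exceeds 1/2, so the square of the weight is integrable. Multiplication by
`decay` therefore takes L² to L¹. -/
theorem decayMass_ne_top : decayMass ≠ ⊤ := by
  have h := integrable_one_add_norm (E := ℝ) (μ := volume) (r := 9 / 8) (by norm_num)
  have h2 (τ : ℝ) : decay 0 τ ^ 2 = ENNReal.ofReal ((1 + ‖τ‖) ^ (-(9 / 8) : ℝ)) := by
    rw [decay, ← ENNReal.ofReal_pow (by have := bracket_pos (τ + 0); positivity),
      ← Real.rpow_natCast, ← Real.rpow_mul (bracket_pos _).le, bracket, add_zero, Real.norm_eq_abs]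
    norm_num
  simp_rw [decayMass, h2]
  exact h.lintegral_lt_top.ne

theorem lintegral_growth_mul_sq {p : ℝ} (f : ℝ → ℝ≥0∞) :
    ∫⁻ τ, (growth p τ * f τ) ^ 2 = weightedSq p f := by
  refine lintegral_congr fun τ ↦ ?_
  rw [mul_pow, growth, ← ENNReal.ofReal_pow (by have := bracket_pos (τ + p); positivity),
      ← Real.rpow_natCast, ← Real.rpow_mul (bracket_pos _).le]
  norm_num

theorem lintegral_growth_mul_decay_sq_le {p : ℝ} {f : ℝ → ℝ≥0∞} (hf : Measurable f) :
    (∫⁻ τ, growth p τ * f τ * decay p τ) ^ 2 ≤ weightedSq p f * decayMass := by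
  rw [← lintegral_growth_mul_sq, ← lintegral_decay_sq p]
  exact lintegral_mul_sq_le _ ((measurable_growth p).mul hf).aemeasurable
    (measurable_decay p).aemeasurable

/-- The arithmetic-geometric mean inequality for ab, bc and ac, with the factor 1/3 dropped. -/
theorem sq_mul_sq_mul_sq_le {a b c : ℝ} (ha : 0 ≤ a) (hb : 0 ≤ b) (hc : 0 ≤ c) :
    a ^ 2 * b ^ 2 * c ^ 2 ≤ a ^ 3 * b ^ 3 + b ^ 3 * c ^ 3 + a ^ 3 * c ^ 3 := by
  have key {x y z : ℝ} (hx : 0 ≤ x) (hy : 0 ≤ y) (hz : 0 ≤ z) :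
      x * y * z ≤ x ^ 3 + y ^ 3 + z ^ 3 := by
    have := mul_nonneg (add_nonneg (add_nonneg hx hy) hz)
      (add_nonneg (add_nonneg (sq_nonneg (x - y)) (sq_nonneg (y - z))) (sq_nonneg (x - z)))
    have := mul_nonneg (mul_nonneg hx hy) hz
    nlinarith
  have := key (mul_nonneg ha hb) (mul_nonneg hb hc) (mul_nonneg ha hc)
  calc _ = a * b * (b * c) * (a * c) := by ring
    _ ≤ _ := this
    _ = _ := by ring

/-- The small factor is traded for l and the other three are spread over pairs. With a = x^(-3/16)
and so on, three powers -3/8 become two powers -9/16. -/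
theorem prod_sq_le_of_small {a b c d l : ℝ} (ha : 0 ≤ a) (hb : 0 ≤ b) (hc : 0 ≤ c) (hd : 0 ≤ d)
    (hl : 0 ≤ l) (h : a ^ 2 ≤ l ∨ b ^ 2 ≤ l ∨ c ^ 2 ≤ l ∨ d ^ 2 ≤ l) :
    a ^ 2 * b ^ 2 * c ^ 2 * d ^ 2 ≤ l * (a ^ 3 * b ^ 3 + a ^ 3 * c ^ 3 + b ^ 3 * c ^ 3 +
      a ^ 3 * d ^ 3 + b ^ 3 * d ^ 3 + c ^ 3 * d ^ 3) := by
  have key {x y z w : ℝ} (hx : 0 ≤ x) (hy : 0 ≤ y) (hz : 0 ≤ z) (h : w ^ 2 ≤ l) :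
      x ^ 2 * y ^ 2 * z ^ 2 * w ^ 2 ≤ l * (x ^ 3 * y ^ 3 + y ^ 3 * z ^ 3 + x ^ 3 * z ^ 3) := by
    rw [mul_comm l]
    have := sq_mul_sq_mul_sq_le hx hy hz
    gcongr
  have h3 {x y z : ℝ} (hx : 0 ≤ x) (hy : 0 ≤ y) (hz : 0 ≤ z) (w : ℝ) (hw : 0 ≤ w) :
    0 ≤ l * (w ^ 3 * x ^ 3 + w ^ 3 * y ^ 3 + w ^ 3 * z ^ 3) := by positivity
  rcases h with h | h | h | h
  · linarith [key hb hc hd h, h3 hb hc hd a ha]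
  · linarith [key ha hc hd h, h3 ha hc hd b hb]
  · linarith [key ha hb hd h, h3 ha hb hd c hc]
  · linarith [key ha hb hc h, h3 ha hb hc d hd]

/-- Each input weight 1/2 exceeds 3/8, so the factor x^(1/2) x^(-3/8) and its analogues may be
inserted for free. All four variables then carry the power -3/8; the large one pays l^(-3/8), and
the rest becomes a sum over pairs. -/
theorem rpow_neg_le_of_large {x y z w l : ℝ} (hx : 1 ≤ x) (hy : 1 ≤ y) (hz : 1 ≤ z) (hw : 1 ≤ w)
    (hl : 0 < l) (h : l ≤ x ∨ l ≤ y ∨ l ≤ z ∨ l ≤ w) :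
    w ^ (-(3 / 8) : ℝ) ≤ l ^ (-(3 / 8) : ℝ) *
      (x ^ (1 / 2 : ℝ) * y ^ (1 / 2 : ℝ) * z ^ (1 / 2 : ℝ) *
        (x ^ (-(9 / 16) : ℝ) * y ^ (-(9 / 16) : ℝ) + x ^ (-(9 / 16) : ℝ) * z ^ (-(9 / 16) : ℝ) +
         y ^ (-(9 / 16) : ℝ) * z ^ (-(9 / 16) : ℝ) + x ^ (-(9 / 16) : ℝ) * w ^ (-(9 / 16) : ℝ) +
         y ^ (-(9 / 16) : ℝ) * w ^ (-(9 / 16) : ℝ) +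
         z ^ (-(9 / 16) : ℝ) * w ^ (-(9 / 16) : ℝ))) := by
  have e2 {t : ℝ} (ht : 1 ≤ t) : (t ^ (-(3 / 16) : ℝ)) ^ 2 = t ^ (-(3 / 8) : ℝ) := by
    rw [← Real.rpow_natCast, ← Real.rpow_mul (by linarith)]; norm_num
  have e3 {t : ℝ} (ht : 1 ≤ t) : (t ^ (-(3 / 16) : ℝ)) ^ 3 = t ^ (-(9 / 16) : ℝ) := by
    rw [← Real.rpow_natCast, ← Real.rpow_mul (by linarith)]; norm_num
  have hle {t : ℝ} (ht : 1 ≤ t) (h : l ≤ t) : (t ^ (-(3 / 16) : ℝ)) ^ 2 ≤ l ^ (-(3 / 8) : ℝ) := by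
    rw [e2 ht]
    exact Real.rpow_le_rpow_of_nonpos hl h (by norm_num)
  have one_le {t : ℝ} (ht : 1 ≤ t) : 1 ≤ t ^ (1 / 2 : ℝ) * t ^ (-(3 / 8) : ℝ) := by
    rw [← Real.rpow_add (by linarith)]
    exact Real.one_le_rpow ht (by norm_num)
  have p {t : ℝ} (ht : 1 ≤ t) : 0 ≤ t ^ (-(3 / 16) : ℝ) := by positivity
  have main := prod_sq_le_of_small (p hx) (p hy) (p hz) (p hw)
    (by positivity : 0 ≤ l ^ (-(3 / 8) : ℝ))
    (h.imp (hle hx) (Or.imp (hle hy) (Or.imp (hle hz) (hle hw))))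
  rw [e2 hx, e2 hy, e2 hz, e2 hw, e3 hx, e3 hy, e3 hz, e3 hw] at main
  have hxyz : 1 ≤ (x ^ (1 / 2 : ℝ) * x ^ (-(3 / 8) : ℝ)) * (y ^ (1 / 2 : ℝ) * y ^ (-(3 / 8) : ℝ)) *
      (z ^ (1 / 2 : ℝ) * z ^ (-(3 / 8) : ℝ)) :=
    one_le_mul_of_one_le_of_one_le (one_le_mul_of_one_le_of_one_le (one_le hx) (one_le hy))
      (one_le hz)
  calc w ^ (-(3 / 8) : ℝ) ≤ ((x ^ (1 / 2 : ℝ) * x ^ (-(3 / 8) : ℝ)) *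
        (y ^ (1 / 2 : ℝ) * y ^ (-(3 / 8) : ℝ)) * (z ^ (1 / 2 : ℝ) * z ^ (-(3 / 8) : ℝ))) *
        w ^ (-(3 / 8) : ℝ) := le_mul_of_one_le_left (by positivity) hxyz
    _ = (x ^ (1 / 2 : ℝ) * y ^ (1 / 2 : ℝ) * z ^ (1 / 2 : ℝ)) * (x ^ (-(3 / 8) : ℝ) *
        y ^ (-(3 / 8) : ℝ) * z ^ (-(3 / 8) : ℝ) * w ^ (-(3 / 8) : ℝ)) := by ring
    _ ≤ _ := mul_le_mul_of_nonneg_left main (by positivity)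
    _ = _ := by ring

theorem ofReal_bracket_rpow_le {p₁ p₂ p₃ p₄ l : ℝ} (hl : 0 < l) {x y z w : ℝ}
    (h : l ≤ bracket (x + p₁) ∨ l ≤ bracket (y + p₂) ∨ l ≤ bracket (z + p₃) ∨
      l ≤ bracket (w + p₄)) :
    ENNReal.ofReal (bracket (w + p₄) ^ (-(3 / 8) : ℝ)) ≤
      ENNReal.ofReal (l ^ (-(3 / 8) : ℝ)) * (growth p₁ x * growth p₂ y * growth p₃ z *
        (decay p₁ x * decay p₂ y + decay p₁ x * decay p₃ z + decay p₂ y * decay p₃ z +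
          decay p₁ x * decay p₄ w + decay p₂ y * decay p₄ w + decay p₃ z * decay p₄ w)) := by
  have h1 := ENNReal.ofReal_le_ofReal (rpow_neg_le_of_large (one_le_bracket _) (one_le_bracket _)
    (one_le_bracket _) (one_le_bracket _) hl h)
  have b1 := bracket_pos (x + p₁)
  have b2 := bracket_pos (y + p₂)
  have b3 := bracket_pos (z + p₃)
  have b4 := bracket_pos (w + p₄)
  refine h1.trans (le_of_eq ?_)
  simp only [growth, decay]
  repeat rw [ENNReal.ofReal_mul (by positivity)]
  repeat rw [ENNReal.ofReal_add (by positivity) (by positivity)]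
  repeat rw [ENNReal.ofReal_mul (by positivity)]

/-- The pointwise bound puts decay on two of the four variables in each of six terms. If both are
inputs, two factors are in L¹ and Young gives L². If one is the output, L¹ * L² * L² is bounded and
the output weight is square integrable. -/
theorem lintegral_weighted_lconvolution_sq_le {f₁ f₂ f₃ : ℝ → ℝ≥0∞} (hf₁ : Measurable f₁)
    (hf₂ : Measurable f₂) (hf₃ : Measurable f₃) {p₁ p₂ p₃ p₄ l : ℝ} (hl : 0 < l)
    (h : ∀ x y z : ℝ, l ≤ bracket (x + p₁) ∨ l ≤ bracket (y + p₂) ∨ l ≤ bracket (z + p₃) ∨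
      l ≤ bracket (x + y + z + p₄)) :
    ∫⁻ τ, (ENNReal.ofReal (bracket (τ + p₄) ^ (-(3 / 8) : ℝ)) * (f₁ ⋆ₗ (f₂ ⋆ₗ f₃)) τ) ^ 2 ≤
      ENNReal.ofReal (l ^ (-(3 / 8) : ℝ)) ^ 2 * (36 * decayMass ^ 2) *
        (weightedSq p₁ f₁ * weightedSq p₂ f₂ * weightedSq p₃ f₃) := by
  set g₁ : ℝ → ℝ≥0∞ := fun τ ↦ growth p₁ τ * f₁ τ with hg₁
  set g₂ : ℝ → ℝ≥0∞ := fun τ ↦ growth p₂ τ * f₂ τ with hg₂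
  set g₃ : ℝ → ℝ≥0∞ := fun τ ↦ growth p₃ τ * f₃ τ with hg₃
  set d₁ : ℝ → ℝ≥0∞ := fun τ ↦ g₁ τ * decay p₁ τ with hd₁
  set d₂ : ℝ → ℝ≥0∞ := fun τ ↦ g₂ τ * decay p₂ τ with hd₂
  set d₃ : ℝ → ℝ≥0∞ := fun τ ↦ g₃ τ * decay p₃ τ with hd₃
  have mg₁ : Measurable g₁ := (measurable_growth _).mul hf₁
  have mg₂ : Measurable g₂ := (measurable_growth _).mul hf₂
  have mg₃ : Measurable g₃ := (measurable_growth _).mul hf₃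
  have md₁ : Measurable d₁ := mg₁.mul (measurable_decay _)
  have md₂ : Measurable d₂ := mg₂.mul (measurable_decay _)
  have md₃ : Measurable d₃ := mg₃.mul (measurable_decay _)
  have md₄ : Measurable (decay p₄) := measurable_decay _
  have G₁ : ∫⁻ τ, g₁ τ ^ 2 = weightedSq p₁ f₁ := lintegral_growth_mul_sq _
  have G₂ : ∫⁻ τ, g₂ τ ^ 2 = weightedSq p₂ f₂ := lintegral_growth_mul_sq _
  have G₃ : ∫⁻ τ, g₃ τ ^ 2 = weightedSq p₃ f₃ := lintegral_growth_mul_sq _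
  have D₁ : (∫⁻ τ, d₁ τ) ^ 2 ≤ weightedSq p₁ f₁ * decayMass := lintegral_growth_mul_decay_sq_le hf₁
  have D₂ : (∫⁻ τ, d₂ τ) ^ 2 ≤ weightedSq p₂ f₂ * decayMass := lintegral_growth_mul_decay_sq_le hf₂
  have D₃ : (∫⁻ τ, d₃ τ) ^ 2 ≤ weightedSq p₃ f₃ * decayMass := lintegral_growth_mul_decay_sq_le hf₃
  set A₁ := weightedSq p₁ f₁
  set A₂ := weightedSq p₂ f₂
  set A₃ := weightedSq p₃ f₃
  -- One entry for each pair of variables carrying decay; d marks an input in L¹ and g an input in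
  -- L².
  let t : Fin 6 → ℝ → ℝ≥0∞ := ![d₁ ⋆ₗ (d₂ ⋆ₗ g₃), d₁ ⋆ₗ (g₂ ⋆ₗ d₃), g₁ ⋆ₗ (d₂ ⋆ₗ d₃),
    fun τ ↦ decay p₄ τ * (d₁ ⋆ₗ (g₂ ⋆ₗ g₃)) τ, fun τ ↦ decay p₄ τ * (g₁ ⋆ₗ (d₂ ⋆ₗ g₃)) τ,
    fun τ ↦ decay p₄ τ * (g₁ ⋆ₗ (g₂ ⋆ₗ d₃)) τ]
  have mt (i : Fin 6) : Measurable (t i) := by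
    fin_cases i <;> simp only [t] <;> simp <;> fun_prop
  have hpt (τ : ℝ) : ENNReal.ofReal (bracket (τ + p₄) ^ (-(3 / 8) : ℝ)) * (f₁ ⋆ₗ (f₂ ⋆ₗ f₃)) τ ≤
      ENNReal.ofReal (l ^ (-(3 / 8) : ℝ)) * ∑ i, t i τ := by
    have expand (a b c : ℝ → ℝ≥0∞) (ha : Measurable a) (hb : Measurable b) (hc : Measurable c) :
        (a ⋆ₗ (b ⋆ₗ c)) τ = ∫⁻ x, ∫⁻ y, a x * (b y * c (-y + (-x + τ))) := by
      simp only [lconvolution]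
      refine lintegral_congr fun x ↦ ?_
      rw [lintegral_const_mul _ (by fun_prop)]
    simp only [t, Fin.sum_univ_six]
    simp only [Matrix.cons_val]
    rw [expand _ _ _ hf₁ hf₂ hf₃, expand _ _ _ md₁ md₂ mg₃, expand _ _ _ md₁ mg₂ md₃,
      expand _ _ _ mg₁ md₂ md₃, expand _ _ _ md₁ mg₂ mg₃, expand _ _ _ mg₁ md₂ mg₃,
      expand _ _ _ mg₁ mg₂ md₃]
    repeat rw [← lintegral_const_mul _ (by fun_prop)]
    repeat rw [← lintegral_add_left (by fun_prop)]
    rw [← lintegral_const_mul _ (by fun_prop)]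
    refine lintegral_mono fun x ↦ ?_
    repeat rw [← lintegral_const_mul _ (by fun_prop)]
    repeat rw [← lintegral_add_left (by fun_prop)]
    rw [← lintegral_const_mul _ (by fun_prop)]
    refine lintegral_mono fun y ↦ ?_
    have hxyz := h x y (-y + (-x + τ))
    rw [show x + y + (-y + (-x + τ)) = τ by ring] at hxyz
    refine (mul_le_mul_left (ofReal_bracket_rpow_le hl hxyz) _).trans (le_of_eq ?_)
    simp only [hg₁, hg₂, hg₃, hd₁, hd₂, hd₃]
    ring
  have hD (F : ℝ → ℝ≥0∞) {c : ℝ≥0∞} (hF : ∀ τ, F τ ^ 2 ≤ c) :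
      ∫⁻ τ, (decay p₄ τ * F τ) ^ 2 ≤ decayMass * c := by
    simp_rw [mul_pow]
    rw [← lintegral_decay_sq p₄, ← lintegral_mul_const _ (by fun_prop)]
    exact lintegral_mono fun τ ↦ mul_le_mul_right (hF τ) _
  have ht (i : Fin 6) : ∫⁻ τ, t i τ ^ 2 ≤ decayMass ^ 2 * (A₁ * A₂ * A₃) := by
    fin_cases i <;> simp only [t] <;> simp
    · calc _ ≤ _ := lintegral_lconvolution_three_sq_le md₁ md₂ mg₃
        _ ≤ (A₁ * decayMass) * ((A₂ * decayMass) * A₃) := by rw [G₃]; gcongr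
        _ = _ := by ring
    -- Commutativity moves the integrable factors to the front; the other cases below do the same.
    · rw [lconvolution_comm (f := g₂)]
      calc _ ≤ _ := lintegral_lconvolution_three_sq_le md₁ md₃ mg₂
        _ ≤ (A₁ * decayMass) * ((A₃ * decayMass) * A₂) := by rw [G₂]; gcongr
        _ = _ := by ring
    · rw [lconvolution_left_comm mg₁ md₂ md₃, lconvolution_comm (f := g₁)]
      calc _ ≤ _ := lintegral_lconvolution_three_sq_le md₂ md₃ mg₁
        _ ≤ (A₂ * decayMass) * ((A₃ * decayMass) * A₁) := by rw [G₁]; gcongr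
        _ = _ := by ring
    · calc _ ≤ _ := hD _ fun τ ↦ lconvolution_three_sq_le md₁ mg₂ mg₃ τ
        _ ≤ decayMass * ((A₁ * decayMass) * (A₂ * A₃)) := by rw [G₂, G₃]; gcongr
        _ = _ := by ring
    · rw [lconvolution_left_comm mg₁ md₂ mg₃]
      calc _ ≤ _ := hD _ fun τ ↦ lconvolution_three_sq_le md₂ mg₁ mg₃ τ
        _ ≤ decayMass * ((A₂ * decayMass) * (A₁ * A₃)) := by rw [G₁, G₃]; gcongr
        _ = _ := by ring
    · rw [lconvolution_comm (f := g₂), lconvolution_left_comm mg₁ md₃ mg₂]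
      calc _ ≤ _ := hD _ fun τ ↦ lconvolution_three_sq_le md₃ mg₁ mg₂ τ
        _ ≤ decayMass * ((A₃ * decayMass) * (A₁ * A₂)) := by rw [G₁, G₂]; gcongr
        _ = _ := by ring
  -- The constant 36 is 6 from Cauchy-Schwarz over six terms, times six equal bounds.
  calc _ ≤ ∫⁻ τ, ENNReal.ofReal (l ^ (-(3 / 8) : ℝ)) ^ 2 * (6 * ∑ i, t i τ ^ 2) := by
        refine lintegral_mono fun τ ↦ (pow_le_pow_left' (hpt τ) 2).trans ?_
        rw [mul_pow]
        exact mul_le_mul_right (fin_sum_sq_le _) _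
    _ = ENNReal.ofReal (l ^ (-(3 / 8) : ℝ)) ^ 2 * (6 * ∑ i, ∫⁻ τ, t i τ ^ 2) := by
        rw [lintegral_const_mul _ (by fun_prop), lintegral_const_mul _ (by fun_prop),
          lintegral_finsetSum _ (by fun_prop)]
    _ ≤ ENNReal.ofReal (l ^ (-(3 / 8) : ℝ)) ^ 2 *
          (6 * ∑ _i : Fin 6, decayMass ^ 2 * (A₁ * A₂ * A₃)) := by
        gcongr with i
        exact ht i
    _ = _ := by
        simp only [Finset.sum_const, Finset.card_univ, Fintype.card_fin, nsmul_eq_mul]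
        push_cast
        ring

/-! ### The resonance function -/

/-- The symbol `αk⁵ - βk³` of the linear part. -/
def phase (α β : ℝ) (k : ℤ) : ℝ := α * (k : ℝ) ^ 5 - β * (k : ℝ) ^ 3

/-- The phase difference factors as abd(5αq - 3β), where a, b, d are the pairwise sums and q = (a² +
b² + d²)/2. Here |abd| ≥ 1, and q controls (1 + |k₂|)². The phase difference is also a signed sum of
the four modulations, so these cannot all be small. -/
theorem exists_resonance_lower_bound {α : ℝ} (β : ℝ) (hα : α ≠ 0) :
    ∃ c : ℝ, 0 < c ∧ ∀ k₁ k₂ k₃ : ℤ, (k₁ + k₂) * (k₂ + k₃) * (k₃ + k₁) ≠ 0 → ∀ x y z : ℝ,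
      c * (1 + |(k₂ : ℝ)|) ^ 2 ≤ bracket (x + phase α β k₁) ∨
      c * (1 + |(k₂ : ℝ)|) ^ 2 ≤ bracket (y + phase α β k₂) ∨
      c * (1 + |(k₂ : ℝ)|) ^ 2 ≤ bracket (z + phase α β k₃) ∨
      c * (1 + |(k₂ : ℝ)|) ^ 2 ≤ bracket (x + y + z + phase α β (k₁ + k₂ + k₃)) := by
  -- The 4 is available because each of the four brackets contains a 1; it covers the values of q
  -- where 5αq - 3β is small or zero.
  obtain ⟨c₀, hc₀, hq⟩ : ∃ c₀ : ℝ, 0 < c₀ ∧ ∀ q : ℝ, 0 ≤ q → c₀ * q ≤ 4 + |5 * α * q - 3 * β| := by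
    have hα' : 0 < |α| := abs_pos.2 hα
    refine ⟨4 * (5 * |α|) / (4 + |3 * β|), by positivity, fun q hq ↦ ?_⟩
    have h1 : 5 * |α| * q ≤ |5 * α * q - 3 * β| + |3 * β| := by
      have := abs_sub_abs_le_abs_sub (5 * α * q) (3 * β)
      rw [abs_mul, abs_mul, abs_of_nonneg hq, abs_of_pos (by norm_num : (0 : ℝ) < 5)] at this
      linarith
    rw [div_mul_eq_mul_div, div_le_iff₀ (by positivity)]
    nlinarith [abs_nonneg (3 * β), abs_nonneg (5 * α * q - 3 * β),
      mul_nonneg (abs_nonneg (3 * β)) (abs_nonneg (5 * α * q - 3 * β))]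
  -- Here 24 = 4 · 6: four brackets, and (1 + |k₂|)² ≤ 6q.
  refine ⟨c₀ / 24, by positivity, fun k₁ k₂ k₃ hne x y z ↦ ?_⟩
  set a : ℤ := k₁ + k₂ with ha
  set b : ℤ := k₂ + k₃ with hb
  set d : ℤ := k₃ + k₁ with hd
  set q : ℝ := ((a : ℝ) ^ 2 + (b : ℝ) ^ 2 + (d : ℝ) ^ 2) / 2 with hqdef
  have habd : (1 : ℝ) ≤ |(a : ℝ) * b * d| := by exact_mod_cast Int.one_le_abs hne
  have hres : phase α β (k₁ + k₂ + k₃) - phase α β k₁ - phase α β k₂ - phase α β k₃ =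
      (a : ℝ) * b * d * (5 * α * q - 3 * β) := by
    simp only [phase, hqdef, ha, hb, hd]; push_cast; ring
  have hk₂ : (1 + |(k₂ : ℝ)|) ^ 2 ≤ 6 * q := by
    have h1 : (2 : ℝ) * k₂ = a + b - d := by simp only [ha, hb, hd]; push_cast; ring
    have h2 : (1 : ℝ) ≤ (a : ℝ) ^ 2 := by
      have : a ≠ 0 := left_ne_zero_of_mul (left_ne_zero_of_mul hne)
      exact_mod_cast Int.one_le_abs (pow_ne_zero 2 this) |>.trans (abs_sq a).le
    have h3 : (1 + |(k₂ : ℝ)|) ^ 2 ≤ 2 * (1 + (k₂ : ℝ) ^ 2) := by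
      rw [← sq_abs (k₂ : ℝ)]; nlinarith [sq_nonneg (1 - |(k₂ : ℝ)|)]
    have h4 : (1 : ℝ) ≤ (b : ℝ) ^ 2 := by
      have : b ≠ 0 := right_ne_zero_of_mul (left_ne_zero_of_mul hne)
      exact_mod_cast Int.one_le_abs (pow_ne_zero 2 this) |>.trans (abs_sq b).le
    have h5 : 4 * (k₂ : ℝ) ^ 2 ≤ 3 * ((a : ℝ) ^ 2 + (b : ℝ) ^ 2 + (d : ℝ) ^ 2) := by
      have : 4 * (k₂ : ℝ) ^ 2 = (a + b - d) ^ 2 := by rw [← h1]; ring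
      rw [this]
      nlinarith [sq_nonneg ((a : ℝ) - b), sq_nonneg ((a : ℝ) + d), sq_nonneg ((b : ℝ) + d)]
    linarith [sq_nonneg (d : ℝ)]
  have hsum : c₀ * q ≤ bracket (x + phase α β k₁) + bracket (y + phase α β k₂) +
      bracket (z + phase α β k₃) + bracket (x + y + z + phase α β (k₁ + k₂ + k₃)) := by
    have h1 : |5 * α * q - 3 * β| ≤ |(a : ℝ) * b * d * (5 * α * q - 3 * β)| := by
      rw [abs_mul]; exact le_mul_of_one_le_left (abs_nonneg _) habd
    rw [← hres] at h1
    have h2 := hq q (by positivity)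
    have h3 : phase α β (k₁ + k₂ + k₃) - phase α β k₁ - phase α β k₂ - phase α β k₃ =
      (x + y + z + phase α β (k₁ + k₂ + k₃)) + -(x + phase α β k₁) + -(y + phase α β k₂) +
        -(z + phase α β k₃) := by ring
    rw [h3] at h1
    have h4 := abs_add_le ((x + y + z + phase α β (k₁ + k₂ + k₃)) + -(x + phase α β k₁) +
      -(y + phase α β k₂)) (-(z + phase α β k₃))
    have h5 := abs_add_le ((x + y + z + phase α β (k₁ + k₂ + k₃)) + -(x + phase α β k₁))
      (-(y + phase α β k₂))
    have h6 := abs_add_le (x + y + z + phase α β (k₁ + k₂ + k₃)) (-(x + phase α β k₁))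
    rw [abs_neg] at h4 h5 h6
    simp only [bracket]
    linarith
  by_contra! hcon
  nlinarith [hcon.1, hcon.2.1, hcon.2.2.1, hcon.2.2.2, mul_le_mul_of_nonneg_left hk₂ hc₀.le]

/-! ### Products of distributions with half a derivative in time -/

theorem ofReal_one_le_bracket (x : ℝ) : 1 ≤ ENNReal.ofReal (bracket x) := by
  rw [ENNReal.one_le_ofReal]; exact one_le_bracket x

theorem lintegral_sq_le_weightedSq (p : ℝ) (f : ℝ → ℝ≥0∞) : ∫⁻ τ, f τ ^ 2 ≤ weightedSq p f :=
  lintegral_mono fun _ ↦ le_mul_of_one_le_left zero_le (ofReal_one_le_bracket _)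

/-- A test function is Schwartz, hence so is its transform; quadratic decay is all that is used. -/
theorem exists_decay_oscIntegral {φ : ℝ → ℂ} (hφ : ContDiff ℝ ∞ φ) (hφ' : HasCompactSupport φ) :
    ∃ C : ℝ, 0 ≤ C ∧ ∀ τ, ‖oscIntegral φ τ‖ ≤ C * (bracket τ ^ 2)⁻¹ := by
  let ψ := hφ'.toSchwartzMap hφ
  obtain ⟨C, hC, h0, h2⟩ : ∃ C : ℝ, 0 ≤ C ∧
      (∀ w : ℝ, ‖FourierTransformInv.fourierInv φ w‖ ≤ C) ∧
      (∀ w : ℝ, |w| ^ 2 * ‖FourierTransformInv.fourierInv φ w‖ ≤ C) := by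
    obtain ⟨C₀, h₀⟩ := (FourierTransformInv.fourierInv ψ).decay 0 0
    obtain ⟨C₂, h₂⟩ := (FourierTransformInv.fourierInv ψ).decay 2 0
    have e (w : ℝ) : FourierTransformInv.fourierInv ψ w = FourierTransformInv.fourierInv φ w := by
      rw [SchwartzMap.fourierInv_coe]; rfl
    simp only [norm_iteratedFDeriv_zero, e, pow_zero, one_mul, Real.norm_eq_abs] at h₀ h₂
    exact ⟨max C₀ C₂, h₀.1.le.trans (le_max_left _ _), fun w ↦ (h₀.2 w).trans (le_max_left _ _),
      fun w ↦ (h₂.2 w).trans (le_max_right _ _)⟩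
  have hpi := Real.two_pi_pos
  refine ⟨2 * (C + (2 * Real.pi) ^ 2 * C), by positivity, fun τ ↦ ?_⟩
  have hb := bracket_pos τ
  rw [← div_eq_mul_inv, le_div_iff₀ (by positivity)]
  have h0' := h0 ((2 * Real.pi)⁻¹ * τ)
  have h2' := h2 ((2 * Real.pi)⁻¹ * τ)
  rw [← oscIntegral_eq_fourierInv, mul_inv_cancel_left₀ hpi.ne'] at h0' h2'
  rw [abs_mul, mul_pow, abs_of_pos (by positivity : 0 < (2 * Real.pi)⁻¹), inv_pow, mul_assoc,
    inv_mul_le_iff₀ (by positivity)] at h2'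
  have hb2 : bracket τ ^ 2 ≤ 2 * (1 + |τ| ^ 2) := by
    rw [bracket]; nlinarith [sq_nonneg (1 - |τ|)]
  nlinarith [mul_le_mul_of_nonneg_left hb2 (norm_nonneg (oscIntegral φ τ))]

theorem lintegral_bracket_inv_sq_ne_top : ∫⁻ τ, ENNReal.ofReal (bracket τ ^ 2)⁻¹ ≠ ⊤ := by
  have h := integrable_one_add_norm (E := ℝ) (μ := volume) (r := 2) (by norm_num)
  have h2 (τ : ℝ) : (bracket τ ^ 2)⁻¹ = (1 + ‖τ‖) ^ (-2 : ℝ) := by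
    rw [Real.rpow_neg (by positivity), bracket, Real.norm_eq_abs, Real.rpow_two]
  simp_rw [h2]
  exact h.lintegral_lt_top.ne

theorem lintegral_oscIntegral_ne_top {φ : ℝ → ℂ} (hφ : ContDiff ℝ ∞ φ)
    (hφ' : HasCompactSupport φ) : ∫⁻ τ, ‖oscIntegral φ τ‖ₑ ≠ ⊤ := by
  obtain ⟨C, hC, h⟩ := exists_decay_oscIntegral hφ hφ'
  refine ne_top_of_le_ne_top (ENNReal.mul_ne_top (ENNReal.ofReal_ne_top (r := C))
    lintegral_bracket_inv_sq_ne_top) ?_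
  have := measurable_bracket
  rw [← lintegral_const_mul _ (by fun_prop)]
  refine lintegral_mono fun τ ↦ ?_
  rw [← ENNReal.ofReal_mul hC, ← ofReal_norm]
  exact ENNReal.ofReal_le_ofReal (h τ)

theorem bracket_add_le_mul (x y : ℝ) : bracket (x + y) ≤ bracket x * bracket y := by
  simp only [bracket]
  nlinarith [abs_add_le x y, abs_nonneg x, abs_nonneg y, mul_nonneg (abs_nonneg x) (abs_nonneg y)]

theorem lintegral_weighted_oscIntegral_ne_top {φ : ℝ → ℂ} (hφ : ContDiff ℝ ∞ φ)
    (hφ' : HasCompactSupport φ) (p : ℝ) :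
    ∫⁻ τ, (ENNReal.ofReal (bracket (τ + p) ^ (3 / 8 : ℝ)) * ‖oscIntegral φ τ‖ₑ) ^ 2 ≠ ⊤ := by
  obtain ⟨C, hC, h⟩ := exists_decay_oscIntegral hφ hφ'
  refine ne_top_of_le_ne_top (ENNReal.mul_ne_top (ENNReal.ofReal_ne_top (r := (bracket p * C) ^ 2))
    lintegral_bracket_inv_sq_ne_top) ?_
  have := measurable_bracket
  rw [← lintegral_const_mul _ (by fun_prop)]
  refine lintegral_mono fun τ ↦ ?_
  have h1 := bracket_pos (τ + p)
  have h2 := bracket_pos τ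
  have h3 := bracket_pos p
  rw [← ENNReal.ofReal_mul (by positivity), ← ofReal_norm, ← ENNReal.ofReal_mul (by positivity),
    ← ENNReal.ofReal_pow (by positivity)]
  refine ENNReal.ofReal_le_ofReal ?_
  have h4 : bracket (τ + p) ^ (3 / 8 : ℝ) ≤ bracket τ * bracket p :=
    (Real.rpow_le_rpow_of_exponent_le (one_le_bracket _) (by norm_num)).trans
      ((Real.rpow_one _).le.trans (bracket_add_le_mul _ _))
  calc (bracket (τ + p) ^ (3 / 8 : ℝ) * ‖oscIntegral φ τ‖) ^ 2
      ≤ (bracket τ * bracket p * (C * (bracket τ ^ 2)⁻¹)) ^ 2 := by gcongr; exact h τ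
    _ = _ := by field_simp

/-- `V` is the function of time with Fourier transform `G`, where `G` is square integrable with
half a power of the weight `⟨τ + p⟩`. -/
structure IsTransformPair (p : ℝ) (G V : ℝ → ℂ) : Prop where
  measurable_left : Measurable G
  measurable_right : Measurable V
  weightedSq_ne_top : weightedSq p (fun τ ↦ ‖G τ‖ₑ) ≠ ⊤
  memLp : MemLp V 2
  lintegral_le : ∫⁻ t, ‖V t‖ₑ ^ 2 ≤ ENNReal.ofReal (2 * Real.pi) * weightedSq p (fun τ ↦ ‖G τ‖ₑ)
  integral_eq : ∀ φ : ℝ → ℂ, Integrable φ → MemLp φ 2 →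
    ∫ τ, G τ * oscIntegral φ τ = ∫ t, V t * φ t

theorem exists_isTransformPair {p : ℝ} {G : ℝ → ℂ} (hG : Measurable G)
    (h : weightedSq p (fun τ ↦ ‖G τ‖ₑ) ≠ ⊤) : ∃ V, IsTransformPair p G V := by
  have hle := lintegral_sq_le_weightedSq p fun τ ↦ ‖G τ‖ₑ
  obtain ⟨V, hV, hV2, hnorm, hint⟩ := exists_dual_transform
    (memLp_two_of_lintegral hG.aestronglyMeasurable (ne_top_of_le_ne_top h hle))
  exact ⟨V, hG, hV, h, hV2, hnorm.le.trans (mul_le_mul_right hle _), hint⟩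

theorem norm_exp_I_mul (ξ t : ℝ) : ‖Complex.exp (Complex.I * (ξ : ℂ) * (t : ℂ))‖ = 1 := by
  rw [show Complex.I * (ξ : ℂ) * (t : ℂ) = ((ξ * t : ℝ) : ℂ) * Complex.I by push_cast; ring]
  exact Complex.norm_exp_ofReal_mul_I _

/-- Modulating the test function by e^{iξt} shifts its transform by ξ, so duality turns the product
into a correlation. -/
theorem IsTransformPair.oscIntegral_mul {p : ℝ} {G V : ℝ → ℂ} (h : IsTransformPair p G V)
    {χ : ℝ → ℂ} (hχ : Integrable χ) (hχ2 : MemLp χ 2) (ξ : ℝ) :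
    oscIntegral (fun t ↦ V t * χ t) ξ = ∫ τ, G τ * oscIntegral χ (τ + ξ) := by
  let e : ℝ → ℂ := fun t ↦ Complex.exp (Complex.I * (ξ : ℂ) * (t : ℂ))
  have he : Continuous e := by fun_prop
  have h1 : Integrable fun t ↦ e t * χ t :=
    hχ.bdd_mul he.aestronglyMeasurable (ae_of_all _ fun t ↦ (norm_exp_I_mul ξ t).le)
  have h2 : MemLp (fun t ↦ e t * χ t) 2 :=
    hχ2.of_le (he.aestronglyMeasurable.mul hχ.1) (ae_of_all _ fun t ↦ by
      rw [norm_mul, norm_exp_I_mul, one_mul])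
  calc oscIntegral (fun t ↦ V t * χ t) ξ = ∫ t, V t * (e t * χ t) := by
        refine integral_congr_ae (ae_of_all _ fun t ↦ ?_)
        simp only [e]; ring
    _ = ∫ τ, G τ * oscIntegral (fun t ↦ e t * χ t) τ := (h.integral_eq _ h1 h2).symm
    _ = _ := by
        refine integral_congr_ae (ae_of_all _ fun τ ↦ ?_)
        simp only [oscIntegral, e]
        congr 1
        refine integral_congr_ae (ae_of_all _ fun t ↦ ?_)
        simp only [← mul_assoc, ← Complex.exp_add]
        congr 2
        push_cast; ring

theorem one_le_growth_mul_decay (p q x y : ℝ) :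
    1 ≤ growth p x * growth q y * (decay p x + decay q y) := by
  have key {s t : ℝ} (hs : 1 ≤ s) (ht : 1 ≤ t) :
      1 ≤ s ^ (1 / 2 : ℝ) * t ^ (1 / 2 : ℝ) * (s ^ (-(9 / 16) : ℝ) + t ^ (-(9 / 16) : ℝ)) := by
    -- With s ≤ t one has s^(1/2) t^(1/2) ≥ s ≥ s^(9/16).
    wlog hst : s ≤ t generalizing s t
    · have := this ht hs (le_of_not_ge hst)
      linarith
    have h0 : 0 ≤ t ^ (-(9 / 16) : ℝ) := by positivity
    calc (1 : ℝ) ≤ s ^ (1 / 2 : ℝ) * s ^ (1 / 2 : ℝ) * s ^ (-(9 / 16) : ℝ) := by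
          rw [← Real.rpow_add (by linarith), ← Real.rpow_add (by linarith)]
          exact Real.one_le_rpow hs (by norm_num)
      _ ≤ s ^ (1 / 2 : ℝ) * t ^ (1 / 2 : ℝ) * (s ^ (-(9 / 16) : ℝ) + t ^ (-(9 / 16) : ℝ)) := by
          gcongr
          linarith
  have h := key (one_le_bracket (x + p)) (one_le_bracket (y + q))
  have b1 := bracket_pos (x + p)
  have b2 := bracket_pos (y + q)
  simp only [growth, decay]
  rw [← ENNReal.ofReal_mul (by positivity), ← ENNReal.ofReal_add (by positivity) (by positivity),
    ← ENNReal.ofReal_mul (by positivity), ENNReal.one_le_ofReal]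
  exact h

theorem lintegral_correlation_sq_le {f g h : ℝ → ℝ≥0∞} (hf : Measurable f) (hg : Measurable g)
    (hh : Measurable h) :
    ∫⁻ ξ, (∫⁻ x, ∫⁻ y, f x * g y * h (y + (x + ξ))) ^ 2 ≤
      (∫⁻ x, f x) ^ 2 * ((∫⁻ x, h x) ^ 2 * ∫⁻ x, g x ^ 2) := by
  -- After reflecting f and g the correlation is a triple convolution, to which Young's inequality
  -- applies.
  have e (ξ : ℝ) : ∫⁻ x, ∫⁻ y, f x * g y * h (y + (x + ξ)) =
      ((fun x ↦ f (-x)) ⋆ₗ (h ⋆ₗ (fun y ↦ g (-y)))) ξ := by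
    rw [lconvolution_comm (f := h)]
    simp only [lconvolution]
    rw [← lintegral_neg_eq_self]
    refine lintegral_congr fun x ↦ ?_
    rw [← lintegral_const_mul _ (by fun_prop), ← lintegral_neg_eq_self]
    refine lintegral_congr fun y ↦ ?_
    rw [mul_assoc]
  simp_rw [e]
  refine (lintegral_lconvolution_three_sq_le (by fun_prop) hh (by fun_prop)).trans (le_of_eq ?_)
  rw [lintegral_neg_eq_self (μ := (volume : Measure ℝ)) f,
    lintegral_neg_eq_self (μ := (volume : Measure ℝ)) (fun y ↦ g y ^ 2)]

section Triple

variable {p₁ p₂ p₃ : ℝ} {G₁ G₂ G₃ V₁ V₂ V₃ : ℝ → ℂ} {φ : ℝ → ℂ}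

theorem integrable_of_test (hφ : ContDiff ℝ ∞ φ) (hφ' : HasCompactSupport φ) : Integrable φ :=
  hφ.continuous.integrable_of_hasCompactSupport hφ'

theorem memLp_of_test (hφ : ContDiff ℝ ∞ φ) (hφ' : HasCompactSupport φ) : MemLp φ 2 :=
  hφ.continuous.memLp_of_hasCompactSupport hφ'

theorem IsTransformPair.mul_test (h₃ : IsTransformPair p₃ G₃ V₃) (hφ : ContDiff ℝ ∞ φ)
    (hφ' : HasCompactSupport φ) :
    Integrable (fun t ↦ V₃ t * φ t) ∧ MemLp (fun t ↦ V₃ t * φ t) 2 := by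
  refine ⟨h₃.memLp.integrable_mul (memLp_of_test hφ hφ'), ?_⟩
  obtain ⟨C, hC⟩ := hφ'.exists_bound_of_continuous hφ.continuous
  refine (h₃.memLp.const_mul (C : ℂ)).of_le
    (h₃.measurable_right.aestronglyMeasurable.mul hφ.continuous.aestronglyMeasurable)
    (ae_of_all _ fun t ↦ ?_)
  rw [norm_mul, norm_mul, mul_comm, Complex.norm_real]
  exact mul_le_mul_of_nonneg_right ((hC t).trans (le_abs_self C)) (norm_nonneg _)

/-- The constant in the product estimates, depending on the test function. -/
noncomputable def testConst (φ : ℝ → ℂ) : ℝ≥0∞ :=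
  4 * decayMass * (∫⁻ τ, ‖oscIntegral φ τ‖ₑ) ^ 2

theorem testConst_ne_top (hφ : ContDiff ℝ ∞ φ) (hφ' : HasCompactSupport φ) : testConst φ ≠ ⊤ := by
  unfold testConst
  finiteness [decayMass_ne_top, lintegral_oscIntegral_ne_top hφ hφ']

/-- Two functions with half a derivative have a locally square integrable product. On the transform
side one of G₂, G₃ can be taken in L¹ and the other in L², while the transform of φ is in L¹. Young
gives L² and Plancherel transfers it to the product, which leaves room for a third L² factor. -/
theorem mul_mul_test (h₂ : IsTransformPair p₂ G₂ V₂) (h₃ : IsTransformPair p₃ G₃ V₃)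
    (hφ : ContDiff ℝ ∞ φ) (hφ' : HasCompactSupport φ) :
    Integrable (fun t ↦ V₂ t * (V₃ t * φ t)) ∧ MemLp (fun t ↦ V₂ t * (V₃ t * φ t)) 2 ∧
    ∫⁻ t, ‖V₂ t * (V₃ t * φ t)‖ₑ ^ 2 ≤
      testConst φ * (weightedSq p₂ (fun τ ↦ ‖G₂ τ‖ₑ) * weightedSq p₃ (fun τ ↦ ‖G₃ τ‖ₑ)) ∧
    ∀ ξ, oscIntegral (fun t ↦ V₂ t * (V₃ t * φ t)) ξ =
      ∫ x, G₂ x * ∫ y, G₃ y * oscIntegral φ (y + (x + ξ)) := by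
  obtain ⟨hi, hm⟩ := h₃.mul_test hφ hφ'
  have hint : Integrable (fun t ↦ V₂ t * (V₃ t * φ t)) := h₂.memLp.integrable_mul hm
  have hosc (ξ : ℝ) : oscIntegral (fun t ↦ V₂ t * (V₃ t * φ t)) ξ =
      ∫ x, G₂ x * ∫ y, G₃ y * oscIntegral φ (y + (x + ξ)) := by
    rw [h₂.oscIntegral_mul hi hm]
    simp_rw [h₃.oscIntegral_mul (integrable_of_test hφ hφ') (memLp_of_test hφ hφ')]
  have mosc : Measurable (oscIntegral φ) :=
    (continuous_oscIntegral (integrable_of_test hφ hφ')).measurable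
  have mG₂ := h₂.measurable_left
  have mG₃ := h₃.measurable_left
  set g₂ : ℝ → ℝ≥0∞ := fun τ ↦ growth p₂ τ * ‖G₂ τ‖ₑ with hg₂
  set g₃ : ℝ → ℝ≥0∞ := fun τ ↦ growth p₃ τ * ‖G₃ τ‖ₑ with hg₃
  set d₂ : ℝ → ℝ≥0∞ := fun τ ↦ g₂ τ * decay p₂ τ with hd₂
  set d₃ : ℝ → ℝ≥0∞ := fun τ ↦ g₃ τ * decay p₃ τ with hd₃
  have mg₂ : Measurable g₂ := (measurable_growth _).mul (by fun_prop)
  have mg₃ : Measurable g₃ := (measurable_growth _).mul (by fun_prop)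
  have md₂ : Measurable d₂ := mg₂.mul (measurable_decay _)
  have md₃ : Measurable d₃ := mg₃.mul (measurable_decay _)
  set I₁ : ℝ → ℝ≥0∞ := fun ξ ↦ ∫⁻ x, ∫⁻ y, d₂ x * g₃ y * ‖oscIntegral φ (y + (x + ξ))‖ₑ
  set I₂ : ℝ → ℝ≥0∞ := fun ξ ↦ ∫⁻ x, ∫⁻ y, g₂ x * d₃ y * ‖oscIntegral φ (y + (x + ξ))‖ₑ
  have hle (ξ : ℝ) : ‖oscIntegral (fun t ↦ V₂ t * (V₃ t * φ t)) ξ‖ₑ ≤ I₁ ξ + I₂ ξ := by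
    rw [hosc]
    calc _ ≤ ∫⁻ x, ‖G₂ x‖ₑ * ∫⁻ y, ‖G₃ y * oscIntegral φ (y + (x + ξ))‖ₑ := by
          refine (enorm_integral_le_lintegral_enorm _).trans (lintegral_mono fun x ↦ ?_)
          simp only [enorm_mul (G₂ x)]
          exact mul_le_mul_right (enorm_integral_le_lintegral_enorm _) _
      _ = ∫⁻ x, ∫⁻ y, ‖G₂ x‖ₑ * ‖G₃ y‖ₑ * ‖oscIntegral φ (y + (x + ξ))‖ₑ := by
          refine lintegral_congr fun x ↦ ?_
          rw [← lintegral_const_mul _ (by fun_prop)]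
          simp only [enorm_mul, mul_assoc]
      _ ≤ ∫⁻ x, ∫⁻ y, (d₂ x * g₃ y * ‖oscIntegral φ (y + (x + ξ))‖ₑ +
            g₂ x * d₃ y * ‖oscIntegral φ (y + (x + ξ))‖ₑ) := by
          refine lintegral_mono fun x ↦ lintegral_mono fun y ↦ ?_
          dsimp only
          rw [← add_mul]
          refine mul_le_mul_left ?_ _
          calc _ ≤ (growth p₂ x * growth p₃ y * (decay p₂ x + decay p₃ y)) *
                (‖G₂ x‖ₑ * ‖G₃ y‖ₑ) := le_mul_of_one_le_left zero_le (one_le_growth_mul_decay _ _ _ _)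
            _ = _ := by simp only [hg₂, hg₃, hd₂, hd₃]; ring
      _ = _ := by
          simp only [I₁, I₂]
          rw [← lintegral_add_left (by fun_prop)]
          refine lintegral_congr fun x ↦ ?_
          rw [← lintegral_add_left (by fun_prop)]
  have hbound : ∫⁻ ξ, ‖oscIntegral (fun t ↦ V₂ t * (V₃ t * φ t)) ξ‖ₑ ^ 2 ≤
      testConst φ * (weightedSq p₂ (fun τ ↦ ‖G₂ τ‖ₑ) * weightedSq p₃ (fun τ ↦ ‖G₃ τ‖ₑ)) := by
    have mI₁ : Measurable I₁ := by fun_prop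
    have B₁ : ∫⁻ ξ, I₁ ξ ^ 2 ≤ _ :=
      lintegral_correlation_sq_le md₂ mg₃ (h := fun τ ↦ ‖oscIntegral φ τ‖ₑ) (by fun_prop)
    have B₂ : ∫⁻ ξ, I₂ ξ ^ 2 ≤ (∫⁻ x, d₃ x) ^ 2 * ((∫⁻ x, ‖oscIntegral φ x‖ₑ) ^ 2 *
        ∫⁻ x, g₂ x ^ 2) := by
      refine le_trans (le_of_eq ?_) (lintegral_correlation_sq_le md₃ mg₂
        (h := fun τ ↦ ‖oscIntegral φ τ‖ₑ) (by fun_prop))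
      refine lintegral_congr fun ξ ↦ ?_
      simp only [I₂]
      rw [lintegral_lintegral_swap (by fun_prop)]
      congr 1
      refine lintegral_congr fun y ↦ lintegral_congr fun x ↦ ?_
      rw [mul_comm (g₂ x), add_left_comm]
    have D₂ : (∫⁻ τ, d₂ τ) ^ 2 ≤ weightedSq p₂ (fun τ ↦ ‖G₂ τ‖ₑ) * decayMass :=
      lintegral_growth_mul_decay_sq_le (by fun_prop)
    have D₃ : (∫⁻ τ, d₃ τ) ^ 2 ≤ weightedSq p₃ (fun τ ↦ ‖G₃ τ‖ₑ) * decayMass :=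
      lintegral_growth_mul_decay_sq_le (by fun_prop)
    have E₂ : ∫⁻ τ, g₂ τ ^ 2 = weightedSq p₂ (fun τ ↦ ‖G₂ τ‖ₑ) := lintegral_growth_mul_sq _
    have E₃ : ∫⁻ τ, g₃ τ ^ 2 = weightedSq p₃ (fun τ ↦ ‖G₃ τ‖ₑ) := lintegral_growth_mul_sq _
    calc _ ≤ ∫⁻ ξ, 2 * (I₁ ξ ^ 2 + I₂ ξ ^ 2) := lintegral_mono fun ξ ↦
          (pow_le_pow_left' (hle ξ) 2).trans (add_sq_le_two_mul _ _)
      _ = 2 * ((∫⁻ ξ, I₁ ξ ^ 2) + ∫⁻ ξ, I₂ ξ ^ 2) := by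
          rw [lintegral_const_mul' _ _ (by simp), lintegral_add_left (by fun_prop)]
      _ ≤ 2 * ((weightedSq p₂ (fun τ ↦ ‖G₂ τ‖ₑ) * decayMass) *
            ((∫⁻ τ, ‖oscIntegral φ τ‖ₑ) ^ 2 * weightedSq p₃ (fun τ ↦ ‖G₃ τ‖ₑ)) +
          (weightedSq p₃ (fun τ ↦ ‖G₃ τ‖ₑ) * decayMass) *
            ((∫⁻ τ, ‖oscIntegral φ τ‖ₑ) ^ 2 * weightedSq p₂ (fun τ ↦ ‖G₂ τ‖ₑ))) := by
          rw [E₃] at B₁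
          rw [E₂] at B₂
          gcongr
          · exact B₁.trans (mul_le_mul_left D₂ _)
          · exact B₂.trans (mul_le_mul_left D₃ _)
      _ = _ := by rw [testConst]; ring
  have hfin := ne_top_of_le_ne_top (ENNReal.mul_ne_top (testConst_ne_top hφ hφ')
    (ENNReal.mul_ne_top h₂.weightedSq_ne_top h₃.weightedSq_ne_top)) hbound
  obtain ⟨hm2, hn2⟩ := memLp_two_of_oscIntegral hint hfin
  exact ⟨hint, hm2, hn2.trans hbound, hosc⟩

theorem lintegral_triple_sq_le (h₁ : IsTransformPair p₁ G₁ V₁) (h₂ : IsTransformPair p₂ G₂ V₂)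
    (h₃ : IsTransformPair p₃ G₃ V₃) (hφ : ContDiff ℝ ∞ φ) (hφ' : HasCompactSupport φ) :
    (∫⁻ t, ‖V₁ t * (V₂ t * (V₃ t * φ t))‖ₑ) ^ 2 ≤
      ENNReal.ofReal (2 * Real.pi) * testConst φ *
        (weightedSq p₁ (fun τ ↦ ‖G₁ τ‖ₑ) * (weightedSq p₂ (fun τ ↦ ‖G₂ τ‖ₑ) *
          weightedSq p₃ (fun τ ↦ ‖G₃ τ‖ₑ))) := by
  obtain ⟨hint, hm2, hn2, -⟩ := mul_mul_test h₂ h₃ hφ hφ'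
  simp_rw [enorm_mul (V₁ _)]
  calc _ ≤ _ := lintegral_mul_sq_le _ h₁.measurable_right.enorm.aemeasurable hint.1.enorm
    _ ≤ _ := mul_le_mul' h₁.lintegral_le hn2
    _ = _ := by ring

theorem integral_triple_eq (h₁ : IsTransformPair p₁ G₁ V₁) (h₂ : IsTransformPair p₂ G₂ V₂)
    (h₃ : IsTransformPair p₃ G₃ V₃) (hφ : ContDiff ℝ ∞ φ) (hφ' : HasCompactSupport φ) :
    ∫ t, V₁ t * (V₂ t * (V₃ t * φ t)) =
      ∫ x, G₁ x * ∫ y, G₂ y * ∫ z, G₃ z * oscIntegral φ (z + (y + x)) := by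
  obtain ⟨hint, hm2, -, hosc⟩ := mul_mul_test h₂ h₃ hφ hφ'
  rw [← h₁.integral_eq _ hint hm2]
  simp_rw [hosc]

/-- The convolution of three functions. -/
noncomputable def tripleConv (G₁ G₂ G₃ : ℝ → ℂ) (τ : ℝ) : ℂ :=
  ∫ x : ℝ × ℝ, G₁ x.1 * (G₂ x.2 * G₃ (-x.2 + (-x.1 + τ)))

/-- The convolution of the absolute values of three functions. -/
noncomputable def absConv (G₁ G₂ G₃ : ℝ → ℂ) : ℝ → ℝ≥0∞ :=
  (fun τ ↦ ‖G₁ τ‖ₑ) ⋆ₗ ((fun τ ↦ ‖G₂ τ‖ₑ) ⋆ₗ (fun τ ↦ ‖G₃ τ‖ₑ))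

theorem absConv_eq (m₁ : Measurable G₁) (m₂ : Measurable G₂) (m₃ : Measurable G₃) (τ : ℝ) :
    absConv G₁ G₂ G₃ τ = ∫⁻ x : ℝ × ℝ, ‖G₁ x.1 * (G₂ x.2 * G₃ (-x.2 + (-x.1 + τ)))‖ₑ := by
  rw [Measure.volume_eq_prod, lintegral_prod _ (by fun_prop)]
  simp only [absConv, lconvolution]
  refine lintegral_congr fun x ↦ ?_
  rw [← lintegral_const_mul _ (by fun_prop)]
  simp only [enorm_mul]

theorem measurable_absConv (m₁ : Measurable G₁) (m₂ : Measurable G₂) (m₃ : Measurable G₃) :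
    Measurable (absConv G₁ G₂ G₃) := by
  unfold absConv; fun_prop

theorem enorm_tripleConv_le (m₁ : Measurable G₁) (m₂ : Measurable G₂) (m₃ : Measurable G₃)
    (τ : ℝ) : ‖tripleConv G₁ G₂ G₃ τ‖ₑ ≤ absConv G₁ G₂ G₃ τ := by
  rw [absConv_eq m₁ m₂ m₃]
  exact enorm_integral_le_lintegral_enorm _

theorem measurable_tripleConv (m₁ : Measurable G₁) (m₂ : Measurable G₂) (m₃ : Measurable G₃) :
    Measurable (tripleConv G₁ G₂ G₃) := by
  have : StronglyMeasurable (Function.uncurry fun (τ : ℝ) (x : ℝ × ℝ) ↦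
      G₁ x.1 * (G₂ x.2 * G₃ (-x.2 + (-x.1 + τ)))) := by
    refine Measurable.stronglyMeasurable ?_
    unfold Function.uncurry
    fun_prop
  exact this.integral_prod_right.measurable

/-- The weights ⟨τ + p⟩^(∓3/8) are split between the convolution and h. Only finiteness is at stake,
so the convolution bound is used with l = 1, which holds for any shifts. -/
theorem lintegral_absConv_mul_sq_le (m₁ : Measurable G₁) (m₂ : Measurable G₂) (m₃ : Measurable G₃)
    {h : ℝ → ℝ≥0∞} (mh : Measurable h) (p₁ p₂ p₃ p : ℝ) :
    (∫⁻ τ, absConv G₁ G₂ G₃ τ * h τ) ^ 2 ≤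
      (36 * decayMass ^ 2 * ∫⁻ τ, (ENNReal.ofReal (bracket (τ + p) ^ (3 / 8 : ℝ)) * h τ) ^ 2) *
      (weightedSq p₁ (fun τ ↦ ‖G₁ τ‖ₑ) * (weightedSq p₂ (fun τ ↦ ‖G₂ τ‖ₑ) *
          weightedSq p₃ (fun τ ↦ ‖G₃ τ‖ₑ))) := by
  have mb := measurable_bracket
  have mc := measurable_absConv m₁ m₂ m₃
  have e (τ : ℝ) : absConv G₁ G₂ G₃ τ * h τ =
      (ENNReal.ofReal (bracket (τ + p) ^ (-(3 / 8) : ℝ)) * absConv G₁ G₂ G₃ τ) *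
      (ENNReal.ofReal (bracket (τ + p) ^ (3 / 8 : ℝ)) * h τ) := by
    have hb := bracket_pos (τ + p)
    have h1 : ENNReal.ofReal (bracket (τ + p) ^ (-(3 / 8) : ℝ)) *
        ENNReal.ofReal (bracket (τ + p) ^ (3 / 8 : ℝ)) = 1 := by
      rw [← ENNReal.ofReal_mul (by positivity), ← Real.rpow_add hb]
      norm_num
    calc _ = 1 * (absConv G₁ G₂ G₃ τ * h τ) := (one_mul _).symm
      _ = _ := by rw [← h1]; ring
  have h1 := lintegral_weighted_lconvolution_sq_le (f₁ := fun τ ↦ ‖G₁ τ‖ₑ) (f₂ := fun τ ↦ ‖G₂ τ‖ₑ)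
    (f₃ := fun τ ↦ ‖G₃ τ‖ₑ) (by fun_prop) (by fun_prop) (by fun_prop) (p₁ := p₁) (p₂ := p₂)
    (p₃ := p₃) (p₄ := p) one_pos (fun x y z ↦ Or.inl (one_le_bracket _))
  simp_rw [e]
  refine (lintegral_mul_sq_le _ (by fun_prop) (by fun_prop)).trans ?_
  refine (mul_le_mul_left h1 _).trans (le_of_eq ?_)
  rw [Real.one_rpow, ENNReal.ofReal_one]
  ring

/-- Products in time correspond to convolutions in τ: Fubini and the shift τ ↦ τ + x + y. -/
theorem integral_tripleConv_mul (h₁ : IsTransformPair p₁ G₁ V₁) (h₂ : IsTransformPair p₂ G₂ V₂)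
    (h₃ : IsTransformPair p₃ G₃ V₃) (hφ : ContDiff ℝ ∞ φ) (hφ' : HasCompactSupport φ) :
    ∫ τ, tripleConv G₁ G₂ G₃ τ * oscIntegral φ τ = ∫ t, V₁ t * (V₂ t * (V₃ t * φ t)) := by
  have m₁ := h₁.measurable_left
  have m₂ := h₂.measurable_left
  have m₃ := h₃.measurable_left
  have mosc : Measurable (oscIntegral φ) :=
    (continuous_oscIntegral (integrable_of_test hφ hφ')).measurable
  have hfin : ∫⁻ τ, absConv G₁ G₂ G₃ τ * ‖oscIntegral φ τ‖ₑ ≠ ⊤ := by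
    intro htop
    have h := lintegral_absConv_mul_sq_le m₁ m₂ m₃ (h := fun τ ↦ ‖oscIntegral φ τ‖ₑ)
      (by fun_prop) p₁ p₂ p₃ 0
    rw [htop, ENNReal.top_pow two_ne_zero, top_le_iff] at h
    exact absurd h (by finiteness [decayMass_ne_top, h₁.weightedSq_ne_top, h₂.weightedSq_ne_top,
      h₃.weightedSq_ne_top, lintegral_weighted_oscIntegral_ne_top hφ hφ' 0])
  let F : ℝ → ℝ × ℝ → ℂ := fun τ x ↦
    G₁ x.1 * (G₂ x.2 * G₃ (-x.2 + (-x.1 + τ))) * oscIntegral φ τ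
  have mF : Measurable (Function.uncurry F) := by
    unfold Function.uncurry; simp only [F]; fun_prop
  have hF : Integrable (Function.uncurry F) (volume.prod volume) := by
    refine ⟨mF.aestronglyMeasurable, ?_⟩
    rw [hasFiniteIntegral_iff_enorm, lintegral_prod _ mF.enorm.aemeasurable]
    refine lt_top_iff_ne_top.2 (ne_top_of_le_ne_top hfin (le_of_eq ?_))
    refine lintegral_congr fun τ ↦ ?_
    rw [absConv_eq m₁ m₂ m₃, ← lintegral_mul_const _ (by fun_prop)]
    simp only [Function.uncurry, F, enorm_mul]
  rw [integral_triple_eq h₁ h₂ h₃ hφ hφ']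
  calc ∫ τ, tripleConv G₁ G₂ G₃ τ * oscIntegral φ τ = ∫ τ, ∫ x, F τ x := by
        refine integral_congr_ae (ae_of_all _ fun τ ↦ ?_)
        simp only [tripleConv, F]
        rw [integral_mul_const]
    _ = ∫ x, ∫ τ, F τ x := integral_integral_swap hF
    _ = ∫ x, ∫ y, ∫ τ, F τ (x, y) := by
        rw [Measure.volume_eq_prod, integral_prod]
        exact hF.integral_prod_right
    _ = _ := by
        refine integral_congr_ae (ae_of_all _ fun x ↦ ?_)
        dsimp only
        rw [← integral_const_mul]
        refine integral_congr_ae (ae_of_all _ fun y ↦ ?_)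
        dsimp only
        rw [← integral_const_mul, ← integral_const_mul,
          ← integral_add_left_eq_self (μ := (volume : Measure ℝ)) _ (y + x)]
        refine integral_congr_ae (ae_of_all _ fun τ ↦ ?_)
        simp only [F]
        rw [show -y + (-x + (y + x + τ)) = τ by ring, add_comm (y + x) τ]
        ring

end Triple

/-! ### The extension of `R(u)` -/

/-- The multiplier of the cubic expression `R`. -/
noncomputable def cubicMult (α β : ℝ) (k₁ k₂ k₃ : ℤ) : ℂ := cubicTerm α β (fun _ ↦ 1) k₁ k₂ k₃

theorem cubicTerm_eq_mul (α β : ℝ) (u : ℤ → ℂ) (k₁ k₂ k₃ : ℤ) :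
    cubicTerm α β u k₁ k₂ k₃ = cubicMult α β k₁ k₂ k₃ * (u k₁ * (u k₂ * u k₃)) := by
  simp only [cubicMult, cubicTerm]
  split_ifs
  · ring
  · simp

theorem bracket_sq_mul_enorm_cubicMult_le {α β c : ℝ} (hc : 0 < c)
    (hden : ∀ m n : ℤ, m ≠ 0 → n ≠ 0 → c * ((m : ℝ) ^ 2 + (n : ℝ) ^ 2) ≤ |denom α β m n|)
    (k : ℤ) (p : ℤ × ℤ) :
    ENNReal.ofReal (bracket k ^ 2) * ‖cubicMult α β p.1 p.2 (k - p.1 - p.2)‖ₑ ≤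
      ENNReal.ofReal (8 / c) * invWeight p.1 := by
  have h := bracket_sq_mul_enorm_cubicTerm_le hc hden (fun _ ↦ 1) p.1 p.2 (k - p.1 - p.2)
  rw [show p.1 + p.2 + (k - p.1 - p.2) = k by ring] at h
  simpa only [cubicMult, enorm_one, mul_one] using h

theorem enorm_cubicMult_le {α β c : ℝ} (hc : 0 < c)
    (hden : ∀ m n : ℤ, m ≠ 0 → n ≠ 0 → c * ((m : ℝ) ^ 2 + (n : ℝ) ^ 2) ≤ |denom α β m n|)
    (k : ℤ) (p : ℤ × ℤ) :
    ‖cubicMult α β p.1 p.2 (k - p.1 - p.2)‖ₑ ≤ ENNReal.ofReal (8 / c) * invWeight p.1 := by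
  refine le_trans (le_mul_of_one_le_left zero_le ?_)
    (bracket_sq_mul_enorm_cubicMult_le hc hden k p)
  rw [ENNReal.one_le_ofReal]
  exact one_le_pow₀ (one_le_bracket _)

/-- This justifies exchanging the frequency sum with an integral. The square root of `a` is in ℓ²,
so the weight 1/|k₁| from the multiplier makes the trilinear sum finite. -/
theorem tsum_cubicMult_mul_ne_top {α β : ℝ} (hα : α ≠ 0) (hnr : NonResonant α β) (k : ℤ)
    {a : ℤ → ℝ≥0∞} (ha : ∑' k, a k ≠ ⊤) {D : ℝ≥0∞} (hD : D ≠ ⊤) {x : ℤ × ℤ → ℝ≥0∞}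
    (hx : ∀ p, x p ^ 2 ≤ D * (a p.1 * (a p.2 * a (k - p.1 - p.2)))) :
    ∑' p : ℤ × ℤ, ‖cubicMult α β p.1 p.2 (k - p.1 - p.2)‖ₑ * x p ≠ ⊤ := by
  obtain ⟨c, hc, hden⟩ := exists_denom_lower_bound hα hnr
  set A : ℤ → ℝ≥0∞ := fun k ↦ a k ^ (1 / 2 : ℝ)
  have hA : ∑' k, A k ^ 2 ≠ ⊤ := by simpa only [A, sq_rpow_half] using ha
  have hx' (p : ℤ × ℤ) : x p ≤ D ^ (1 / 2 : ℝ) * (A p.1 * (A p.2 * A (k - p.1 - p.2))) := by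
    refine (ENNReal.pow_le_pow_left_iff two_ne_zero).1 ?_
    simpa only [A, mul_pow, sq_rpow_half] using hx p
  have hsum : ∑' p : ℤ × ℤ, invWeight p.1 * (A p.1 * (A p.2 * A (k - p.1 - p.2))) ≠ ⊤ := by
    intro htop
    have h2 := tsum_invWeight_mul_three_sq_le A k
    rw [htop, ENNReal.top_pow two_ne_zero, top_le_iff] at h2
    exact absurd h2 (ENNReal.mul_ne_top tsum_invWeight_sq_ne_top (ENNReal.pow_ne_top hA))
  refine ne_top_of_le_ne_top (b := ENNReal.ofReal (8 / c) * D ^ (1 / 2 : ℝ) *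
    ∑' p : ℤ × ℤ, invWeight p.1 * (A p.1 * (A p.2 * A (k - p.1 - p.2)))) ?_ ?_
  · exact ENNReal.mul_ne_top (ENNReal.mul_ne_top ENNReal.ofReal_ne_top
      (ENNReal.rpow_ne_top_of_nonneg (by norm_num) hD)) hsum
  · rw [← ENNReal.tsum_mul_left]
    refine ENNReal.tsum_le_tsum fun p ↦ ?_
    calc _ ≤ _ := mul_le_mul' (enorm_cubicMult_le hc hden k p) (hx' p)
      _ = _ := by ring

/-- Space-time Fourier transform of the extension of `R(u)` obtained from an extension of `u` with
space-time Fourier transform `G`. -/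
noncomputable def extCoeff (α β : ℝ) (G : ℤ → ℝ → ℂ) (k : ℤ) (τ : ℝ) : ℂ :=
  if k = 0 then 0 else -(Complex.I / 2) * ∑' p : ℤ × ℤ,
    cubicMult α β p.1 p.2 (k - p.1 - p.2) * tripleConv (G p.1) (G p.2) (G (k - p.1 - p.2)) τ

/-- A majorant of `extCoeff`. -/
noncomputable def extMajorant (α β : ℝ) (G : ℤ → ℝ → ℂ) (k : ℤ) (τ : ℝ) : ℝ≥0∞ :=
  ∑' p : ℤ × ℤ, ‖cubicMult α β p.1 p.2 (k - p.1 - p.2)‖ₑ *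
    absConv (G p.1) (G p.2) (G (k - p.1 - p.2)) τ

theorem enorm_neg_I_div_two_le : ‖-(Complex.I / 2)‖ₑ ≤ 1 := by
  rw [← ofReal_norm]
  norm_num

theorem enorm_extCoeff_le (α β : ℝ) {G : ℤ → ℝ → ℂ} (hG : ∀ k, Measurable (G k)) (k : ℤ) (τ : ℝ) :
    ‖extCoeff α β G k τ‖ₑ ≤ extMajorant α β G k τ := by
  rw [extCoeff]
  split_ifs
  · simp
  · rw [enorm_mul]
    refine (mul_le_mul' enorm_neg_I_div_two_le enorm_tsum_le_tsum_enorm).trans ?_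
    rw [one_mul]
    refine ENNReal.tsum_le_tsum fun p ↦ ?_
    rw [enorm_mul]
    exact mul_le_mul_right (enorm_tripleConv_le (hG _) (hG _) (hG _) τ) _

theorem tsum_bracket_rpow_sq_ne_top :
    ∑' j : ℤ, ENNReal.ofReal (bracket j ^ (-(3 / 4) : ℝ)) ^ 2 ≠ ⊤ := by
  have e (j : ℤ) : ENNReal.ofReal (bracket j ^ (-(3 / 4) : ℝ)) ^ 2 =
      ENNReal.ofReal (bracket j ^ (-(3 / 2) : ℝ)) := by
    have := bracket_pos j
    rw [← ENNReal.ofReal_pow (by positivity), ← Real.rpow_natCast, ← Real.rpow_mul this.le]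
    norm_num
  have hs : Summable fun j : ℤ ↦ bracket j ^ (-(3 / 2) : ℝ) := by
    refine Summable.of_norm_bounded_eventually
      (Real.summable_abs_int_rpow (b := 3 / 2) (by norm_num)) ?_
    rw [Filter.eventually_cofinite]
    refine (Set.finite_singleton (0 : ℤ)).subset fun j hj ↦ ?_
    by_contra h0
    refine hj ?_
    have hj' : (0 : ℝ) < |(j : ℝ)| := abs_pos.2 (by exact_mod_cast h0)
    have := bracket_pos j
    rw [Real.norm_of_nonneg (by positivity)]
    exact Real.rpow_le_rpow_of_nonpos hj' (by simp [bracket]) (by norm_num)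
  simp_rw [e]
  rw [← ENNReal.ofReal_tsum_of_nonneg (fun j ↦ by have := bracket_pos j; positivity) hs]
  exact ENNReal.ofReal_ne_top

theorem tsum_tsum_three (a : ℤ → ℝ≥0∞) :
    ∑' k : ℤ, ∑' p : ℤ × ℤ, a p.1 * (a p.2 * a (k - p.1 - p.2)) = (∑' k, a k) ^ 3 := by
  have h (p : ℤ × ℤ) : ∑' k : ℤ, a p.1 * (a p.2 * a (k - p.1 - p.2)) =
      a p.1 * (a p.2 * ∑' k, a k) := by
    rw [ENNReal.tsum_mul_left, ENNReal.tsum_mul_left, ← (Equiv.subRight (p.1 + p.2)).tsum_eq a]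
    simp only [Equiv.subRight_apply, sub_sub]
  rw [ENNReal.tsum_comm]
  simp_rw [h]
  rw [ENNReal.tsum_prod']
  simp only [ENNReal.tsum_mul_left, ENNReal.tsum_mul_right]
  ring

/-- The trilinear estimate in Bourgain spaces. -/
theorem exists_extMajorant_bound {α β : ℝ} (hα : α ≠ 0) (hnr : NonResonant α β) :
    ∃ C : ℝ, 0 < C ∧ ∀ G : ℤ → ℝ → ℂ, (∀ k, Measurable (G k)) →
      ∑' k : ℤ, ∫⁻ τ, (ENNReal.ofReal (bracket k ^ 2) *
        (ENNReal.ofReal (bracket (τ + phase α β k) ^ (-(3 / 8) : ℝ)) *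
          extMajorant α β G k τ)) ^ 2 ≤
      ENNReal.ofReal C ^ 2 * (∑' k, weightedSq (phase α β k) (fun τ ↦ ‖G k τ‖ₑ)) ^ 3 := by
  obtain ⟨c, hc, hden⟩ := exists_denom_lower_bound hα hnr
  obtain ⟨d, hd, hres⟩ := exists_resonance_lower_bound β hα
  -- The exponent 3/4 is the gain ((1 + |k₂|)²)^(-3/8) from the resonance; it exceeds 1/2, so M is
  -- in ℓ².
  set M : ℤ → ℝ≥0∞ := fun j ↦ ENNReal.ofReal (bracket j ^ (-(3 / 4) : ℝ)) with hM
  set N : ℤ → ℝ≥0∞ := fun j ↦ ENNReal.ofReal (bracket j ^ (3 / 4 : ℝ)) with hN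
  have hMN (j : ℤ) : M j * N j = 1 := by
    have hb := bracket_pos j
    rw [hM, hN, ← ENNReal.ofReal_mul (by positivity), ← Real.rpow_add hb]
    norm_num
  set S : ℝ≥0∞ := ∑' p : ℤ × ℤ, (invWeight p.1 * M p.2) ^ 2 with hS
  have hStop : S ≠ ⊤ := by
    rw [hS, ENNReal.tsum_prod']
    simp only [mul_pow, ENNReal.tsum_mul_left, ENNReal.tsum_mul_right]
    exact ENNReal.mul_ne_top tsum_invWeight_sq_ne_top tsum_bracket_rpow_sq_ne_top
  set K : ℝ≥0∞ := ENNReal.ofReal (8 / c) with hK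
  set L : ℝ≥0∞ := ENNReal.ofReal (d ^ (-(3 / 8) : ℝ)) ^ 2 * (36 * decayMass ^ 2) with hL
  obtain ⟨C, hC, hKC⟩ := exists_le_ofReal_sq (K := S * (K ^ 2 * L))
    (by finiteness [decayMass_ne_top])
  refine ⟨C, hC, fun G hG ↦ ?_⟩
  set a : ℤ → ℝ≥0∞ := fun k ↦ weightedSq (phase α β k) (fun τ ↦ ‖G k τ‖ₑ) with ha
  have mb := measurable_bracket
  -- N cancels the factor M split off for Cauchy-Schwarz, and the resonance gain in turn cancels N.
  -- Outside the condition the multiplier vanishes.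
  let Q : ℤ → ℤ × ℤ → ℝ → ℝ≥0∞ := fun k p τ ↦
    if (p.1 + p.2) * (p.2 + (k - p.1 - p.2)) * ((k - p.1 - p.2) + p.1) ≠ 0 then
      N p.2 * (ENNReal.ofReal (bracket (τ + phase α β k) ^ (-(3 / 8) : ℝ)) *
        absConv (G p.1) (G p.2) (G (k - p.1 - p.2)) τ) else 0
  have mQ (k : ℤ) (p : ℤ × ℤ) : Measurable (Q k p) := by
    have := measurable_absConv (hG p.1) (hG p.2) (hG (k - p.1 - p.2))
    simp only [Q]
    split_ifs <;> fun_prop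
  have hQ (k : ℤ) (p : ℤ × ℤ) :
      ∫⁻ τ, Q k p τ ^ 2 ≤ L * (a p.1 * (a p.2 * a (k - p.1 - p.2))) := by
    simp only [Q]
    split_ifs with hcond
    · have hb := bracket_pos p.2
      have hl : 0 < d * (1 + |(p.2 : ℝ)|) ^ 2 := by positivity
      have h1 := lintegral_weighted_lconvolution_sq_le (f₁ := fun τ ↦ ‖G p.1 τ‖ₑ)
        (f₂ := fun τ ↦ ‖G p.2 τ‖ₑ) (f₃ := fun τ ↦ ‖G (k - p.1 - p.2) τ‖ₑ) (hG _).enorm (hG _).enorm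
        (hG _).enorm hl (hres p.1 p.2 (k - p.1 - p.2) hcond)
      rw [show p.1 + p.2 + (k - p.1 - p.2) = k by ring] at h1
      have h2 : ENNReal.ofReal ((d * (1 + |(p.2 : ℝ)|) ^ 2) ^ (-(3 / 8) : ℝ)) =
          ENNReal.ofReal (d ^ (-(3 / 8) : ℝ)) * M p.2 := by
        rw [hM, ← ENNReal.ofReal_mul (by positivity), Real.mul_rpow hd.le (by positivity),
          ← Real.rpow_natCast, ← Real.rpow_mul (by positivity), bracket]
        norm_num
      rw [h2] at h1
      simp_rw [mul_pow (N p.2)]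
      rw [lintegral_const_mul' _ _ (by simp [hN])]
      calc _ ≤ _ := mul_le_mul_right h1 _
        _ = (M p.2 * N p.2) ^ 2 * (L * (a p.1 * (a p.2 * a (k - p.1 - p.2)))) := by
            simp only [hL, ha]; ring
        _ = _ := by rw [hMN, one_pow, one_mul]
    · simp
  have hpt (k : ℤ) (τ : ℝ) : (ENNReal.ofReal (bracket k ^ 2) *
      (ENNReal.ofReal (bracket (τ + phase α β k) ^ (-(3 / 8) : ℝ)) * extMajorant α β G k τ)) ^ 2 ≤
      S * ∑' p : ℤ × ℤ, K ^ 2 * Q k p τ ^ 2 := by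
    have h1 : ENNReal.ofReal (bracket k ^ 2) *
        (ENNReal.ofReal (bracket (τ + phase α β k) ^ (-(3 / 8) : ℝ)) * extMajorant α β G k τ) ≤
        ∑' p : ℤ × ℤ, (invWeight p.1 * M p.2) * (K * Q k p τ) := by
      rw [extMajorant, ← ENNReal.tsum_mul_left, ← ENNReal.tsum_mul_left]
      refine ENNReal.tsum_le_tsum fun p ↦ ?_
      simp only [Q]
      split_ifs with hcond
      · calc _ = ENNReal.ofReal (bracket k ^ 2) * ‖cubicMult α β p.1 p.2 (k - p.1 - p.2)‖ₑ *
              (ENNReal.ofReal (bracket (τ + phase α β k) ^ (-(3 / 8) : ℝ)) *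
                absConv (G p.1) (G p.2) (G (k - p.1 - p.2)) τ) := by ring
          _ ≤ (K * invWeight p.1) * (ENNReal.ofReal (bracket (τ + phase α β k) ^ (-(3 / 8) : ℝ)) *
                absConv (G p.1) (G p.2) (G (k - p.1 - p.2)) τ) :=
              mul_le_mul_left (bracket_sq_mul_enorm_cubicMult_le hc hden k p) _
          _ = (M p.2 * N p.2) * ((K * invWeight p.1) *
              (ENNReal.ofReal (bracket (τ + phase α β k) ^ (-(3 / 8) : ℝ)) *
                absConv (G p.1) (G p.2) (G (k - p.1 - p.2)) τ)) := by rw [hMN, one_mul]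
          _ = _ := by ring
      · have : cubicMult α β p.1 p.2 (k - p.1 - p.2) = 0 := by
          rw [cubicMult, cubicTerm, if_neg fun h ↦ hcond h.2]
        simp [this]
    refine (pow_le_pow_left' h1 2).trans ((tsum_mul_sq_le _ _).trans (le_of_eq ?_))
    simp only [mul_pow K]
    rfl
  -- After Cauchy-Schwarz only the sum of products of squared norms over all k and (k₁, k₂) is left,
  -- and it factors into a cube.
  calc _ ≤ ∑' k : ℤ, S * (K ^ 2 * ∑' p : ℤ × ℤ, L * (a p.1 * (a p.2 * a (k - p.1 - p.2)))) := by
        refine ENNReal.tsum_le_tsum fun k ↦ (lintegral_mono (hpt k)).trans ?_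
        rw [lintegral_const_mul' _ _ hStop, lintegral_tsum fun p ↦ by have := mQ k p; fun_prop,
          ← ENNReal.tsum_mul_left (a := K ^ 2)]
        refine mul_le_mul_right (ENNReal.tsum_le_tsum fun p ↦ ?_) _
        rw [lintegral_const_mul _ (by have := mQ k p; fun_prop)]
        exact mul_le_mul_right (hQ k p) _
    _ = S * (K ^ 2 * L) * (∑' k, a k) ^ 3 := by
        simp only [ENNReal.tsum_mul_left, tsum_tsum_three]
        ring
    _ ≤ _ := mul_le_mul_left hKC _

theorem xNorm_extCoeff_le {α β s ε : ℝ} (hs : s ≤ 2) (hε : ε ≤ 1 / 8) {G : ℤ → ℝ → ℂ}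
    (hG : ∀ k, Measurable (G k)) {D : ℝ≥0∞}
    (h : ∑' k : ℤ, ∫⁻ τ, (ENNReal.ofReal (bracket k ^ 2) *
        (ENNReal.ofReal (bracket (τ + phase α β k) ^ (-(3 / 8) : ℝ)) *
          extMajorant α β G k τ)) ^ 2 ≤ D ^ 2) :
    xNorm α β s (-1 / 2 + ε) (extCoeff α β G) ≤ D := by
  rw [xNorm, one_div, ENNReal.rpow_inv_le_iff (by norm_num), ENNReal.rpow_two]
  refine le_trans (ENNReal.tsum_le_tsum fun k ↦ lintegral_mono fun τ ↦ ?_) h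
  have hb := bracket_pos k
  have hw := bracket_pos (τ + phase α β k)
  rw [show τ + α * (k : ℝ) ^ 5 - β * (k : ℝ) ^ 3 = τ + phase α β k by rw [phase]; ring,
    ← mul_assoc, mul_pow, ← ENNReal.ofReal_mul (by positivity), ← ENNReal.ofReal_pow (by positivity)]
  refine mul_le_mul' (ENNReal.ofReal_le_ofReal ?_)
    (pow_le_pow_left' (enorm_extCoeff_le α β hG k τ) 2)
  rw [mul_pow, ← pow_mul, ← Real.rpow_natCast, ← Real.rpow_natCast, ← Real.rpow_mul hw.le]
  refine mul_le_mul (Real.rpow_le_rpow_of_exponent_le (one_le_bracket _) ?_)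
    (Real.rpow_le_rpow_of_exponent_le (one_le_bracket _) ?_) (by positivity) (by positivity)
  · push_cast; linarith
  · push_cast; linarith

theorem xNorm_zero_half_sq (α β : ℝ) (G : ℤ → ℝ → ℂ) :
    xNorm α β 0 (1 / 2) G ^ 2 = ∑' k, weightedSq (phase α β k) (fun τ ↦ ‖G k τ‖ₑ) := by
  rw [xNorm, sq_rpow_half]
  refine tsum_congr fun k ↦ lintegral_congr fun τ ↦ ?_
  rw [show τ + α * (k : ℝ) ^ 5 - β * (k : ℝ) ^ 3 = τ + phase α β k by rw [phase]; ring]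
  norm_num

/-! ### The extension property -/

section Tsum

variable {X ι : Type*} [MeasurableSpace X] {μ : Measure X} [Countable ι] {f : ι → X → ℂ}

/-- The sum is an a.e. limit of its finite partial sums; divergence is confined to a null set. -/
theorem aestronglyMeasurable_tsum (hf : ∀ i, AEStronglyMeasurable (f i) μ)
    (h : ∀ᵐ x ∂μ, ∑' i, ‖f i x‖ₑ ≠ ⊤) : AEStronglyMeasurable (fun x ↦ ∑' i, f i x) μ := by
  refine aestronglyMeasurable_of_tendsto_ae (u := (Filter.atTop : Filter (Finset ι)))
    (f := fun s x ↦ ∑ i ∈ s, f i x)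
    (fun s ↦ Finset.aestronglyMeasurable_fun_sum s fun i _ ↦ hf i) ?_
  filter_upwards [h] with x hx
  exact (summable_of_tsum_enorm_ne_top hx).hasSum

theorem integrable_tsum (hf : ∀ i, AEStronglyMeasurable (f i) μ)
    (h : ∑' i, ∫⁻ x, ‖f i x‖ₑ ∂μ ≠ ⊤) : Integrable (fun x ↦ ∑' i, f i x) μ := by
  rw [← lintegral_tsum fun i ↦ (hf i).enorm] at h
  refine ⟨aestronglyMeasurable_tsum hf ?_, ?_⟩
  · filter_upwards [ae_lt_top' (.tsum fun i ↦ (hf i).enorm) h] with x hx using hx.ne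
  · rw [hasFiniteIntegral_iff_enorm]
    exact (lintegral_mono fun x ↦ enorm_tsum_le_tsum_enorm).trans_lt (lt_top_iff_ne_top.2 h)

end Tsum

theorem aestronglyMeasurable_extCoeff {α β : ℝ} {G : ℤ → ℝ → ℂ} (hG : ∀ k, Measurable (G k))
    (h : ∑' k : ℤ, ∫⁻ τ, (ENNReal.ofReal (bracket k ^ 2) *
        (ENNReal.ofReal (bracket (τ + phase α β k) ^ (-(3 / 8) : ℝ)) *
          extMajorant α β G k τ)) ^ 2 ≠ ⊤) (k : ℤ) :
    AEStronglyMeasurable (extCoeff α β G k) := by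
  unfold extCoeff
  split_ifs
  · exact aestronglyMeasurable_const
  refine AEStronglyMeasurable.const_mul ?_ _
  refine aestronglyMeasurable_tsum (fun p ↦
    ((measurable_tripleConv (hG _) (hG _) (hG _)).const_mul _).aestronglyMeasurable) ?_
  have mb := measurable_bracket
  have mE : Measurable (extMajorant α β G k) := Measurable.tsum fun p ↦
    (measurable_absConv (hG _) (hG _) (hG _)).const_mul _
  have hk := ENNReal.ne_top_of_tsum_ne_top h k
  filter_upwards [ae_lt_top (by fun_prop) hk] with τ hτ
  have hb := bracket_pos k
  have hw := bracket_pos (τ + phase α β k)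
  -- Both weights are positive, so an infinite majorant would make the a.e. finite integrand
  -- infinite.
  have hE : extMajorant α β G k τ ≠ ⊤ := by
    intro htop
    rw [htop, ENNReal.mul_top, ENNReal.mul_top, ENNReal.top_pow two_ne_zero] at hτ
    · exact lt_irrefl _ hτ
    · simp only [ne_eq, ENNReal.ofReal_eq_zero, not_le]; positivity
    · simp only [ne_eq, ENNReal.ofReal_eq_zero, not_le]; positivity
  refine ne_top_of_le_ne_top hE (ENNReal.tsum_le_tsum fun p ↦ ?_)
  rw [enorm_mul]
  exact mul_le_mul_right (enorm_tripleConv_le (hG _) (hG _) (hG _) τ) _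

section Extension

variable {α β : ℝ} {G V : ℤ → ℝ → ℂ} {φ : ℝ → ℂ}

/-- Both sides are sums over (k₁, k₂) that agree term by term through `integral_tripleConv_mul`.
Absolute summability on the time side and on the τ side permits the exchange with the integrals. -/
theorem integrable_rCoeff_mul_test (hα : α ≠ 0) (hnr : NonResonant α β)
    (hGV : ∀ k, IsTransformPair (phase α β k) (G k) (V k))
    (hfin : ∑' k, weightedSq (phase α β k) (fun τ ↦ ‖G k τ‖ₑ) ≠ ⊤)
    (hφ : ContDiff ℝ ∞ φ) (hφ' : HasCompactSupport φ) (k : ℤ) :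
    Integrable (fun t ↦ rCoeff α β (fun j ↦ V j t) k * φ t) ∧
      pairing (extCoeff α β G k) φ = ∫ t, rCoeff α β (fun j ↦ V j t) k * φ t := by
  rcases eq_or_ne k 0 with rfl | hk
  · simp [rCoeff, pairing, extCoeff]
  have mG (k : ℤ) := (hGV k).measurable_left
  have mV (k : ℤ) := (hGV k).measurable_right
  have mφ : Measurable φ := hφ.continuous.measurable
  have mosc : Measurable (oscIntegral φ) :=
    (continuous_oscIntegral (integrable_of_test hφ hφ')).measurable
  let T : ℤ × ℤ → ℝ → ℂ := fun p t ↦ cubicMult α β p.1 p.2 (k - p.1 - p.2) *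
    (V p.1 t * (V p.2 t * (V (k - p.1 - p.2) t * φ t)))
  let F : ℤ × ℤ → ℝ → ℂ := fun p τ ↦ cubicMult α β p.1 p.2 (k - p.1 - p.2) *
    (tripleConv (G p.1) (G p.2) (G (k - p.1 - p.2)) τ * oscIntegral φ τ)
  have mT (p : ℤ × ℤ) : AEStronglyMeasurable (T p) := by
    refine Measurable.aestronglyMeasurable ?_
    simp only [T]
    fun_prop
  have mF (p : ℤ × ℤ) : AEStronglyMeasurable (F p) :=
    (((measurable_tripleConv (mG _) (mG _) (mG _)).mul mosc).const_mul _).aestronglyMeasurable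
  have hT : ∑' p, ∫⁻ t, ‖T p t‖ₑ ≠ ⊤ := by
    have h := tsum_cubicMult_mul_ne_top hα hnr k hfin
      (D := ENNReal.ofReal (2 * Real.pi) * testConst φ) (by finiteness [testConst_ne_top hφ hφ'])
      (x := fun p ↦ ∫⁻ t, ‖V p.1 t * (V p.2 t * (V (k - p.1 - p.2) t * φ t))‖ₑ)
      (fun p ↦ lintegral_triple_sq_le (hGV _) (hGV _) (hGV _) hφ hφ')
    convert h using 3 with p
    simp only [T, enorm_mul (cubicMult _ _ _ _ _)]
    rw [lintegral_const_mul _ (by fun_prop)]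
  have hF : ∑' p, ∫⁻ τ, ‖F p τ‖ₑ ≠ ⊤ := by
    have h := tsum_cubicMult_mul_ne_top hα hnr k hfin
      (D := 36 * decayMass ^ 2 * ∫⁻ τ, (ENNReal.ofReal (bracket (τ + 0) ^ (3 / 8 : ℝ)) *
        ‖oscIntegral φ τ‖ₑ) ^ 2)
      (by finiteness [decayMass_ne_top, lintegral_weighted_oscIntegral_ne_top hφ hφ' 0])
      (x := fun p ↦ ∫⁻ τ, absConv (G p.1) (G p.2) (G (k - p.1 - p.2)) τ * ‖oscIntegral φ τ‖ₑ)
      (fun p ↦ lintegral_absConv_mul_sq_le (mG _) (mG _) (mG _) mosc.enorm _ _ _ _)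
    refine ne_top_of_le_ne_top h (ENNReal.tsum_le_tsum fun p ↦ ?_)
    have := measurable_absConv (mG p.1) (mG p.2) (mG (k - p.1 - p.2))
    rw [← lintegral_const_mul _ (by fun_prop)]
    refine lintegral_mono fun τ ↦ ?_
    simp only [F, enorm_mul]
    gcongr
    exact enorm_tripleConv_le (mG _) (mG _) (mG _) τ
  have eT (t : ℝ) : rCoeff α β (fun j ↦ V j t) k * φ t = -(Complex.I / 2) * ∑' p, T p t := by
    rw [rCoeff, if_neg hk, mul_assoc, ← tsum_mul_right]
    congr 1
    refine tsum_congr fun p ↦ ?_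
    simp only [rTerm, cubicTerm_eq_mul, T]
    ring
  have eF (τ : ℝ) : extCoeff α β G k τ * oscIntegral φ τ = -(Complex.I / 2) * ∑' p, F p τ := by
    rw [extCoeff, if_neg hk, mul_assoc, ← tsum_mul_right]
    congr 1
    refine tsum_congr fun p ↦ ?_
    simp only [F]
    ring
  constructor
  · simp_rw [eT]
    exact (integrable_tsum mT hT).const_mul _
  · change ∫ τ, extCoeff α β G k τ * oscIntegral φ τ = _
    simp_rw [eT, eF]
    rw [integral_const_mul, integral_const_mul, integral_tsum mF hF, integral_tsum mT hT]
    congr 1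
    refine tsum_congr fun p ↦ ?_
    simp only [F, T]
    rw [integral_const_mul, integral_const_mul,
      integral_tripleConv_mul (hGV _) (hGV _) (hGV _) hφ hφ']

theorem locallyIntegrable_rCoeff (hα : α ≠ 0) (hnr : NonResonant α β)
    (hGV : ∀ k, IsTransformPair (phase α β k) (G k) (V k))
    (hfin : ∑' k, weightedSq (phase α β k) (fun τ ↦ ‖G k τ‖ₑ) ≠ ⊤) (k : ℤ) :
    LocallyIntegrable (fun t ↦ rCoeff α β (fun j ↦ V j t) k) := by
  rw [locallyIntegrable_iff]
  intro K hK
  obtain ⟨R, hR, hKR⟩ := hK.isBounded.subset_closedBall_lt 0 0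
  -- A bump equal to 1 on K turns integrability against test functions into integrability on K.
  let b : ContDiffBump (0 : ℝ) := ⟨R, R + 1, hR, by linarith⟩
  have h := (integrable_rCoeff_mul_test hα hnr hGV hfin (φ := fun t ↦ (b t : ℂ))
    (Complex.ofRealCLM.contDiff.comp b.contDiff)
    (b.hasCompactSupport.comp_left Complex.ofReal_zero) k).1
  refine (h.integrableOn (s := K)).congr_fun (fun t ht ↦ ?_) hK.measurableSet
  dsimp only
  rw [b.one_of_mem_closedBall (hKR ht), Complex.ofReal_one, mul_one]

theorem ae_eq_of_isExtension {δ : ℝ} {v W : ℝ → ℂ} (hv : LocallyIntegrableOn v (Ioo 0 δ))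
    (hW : LocallyIntegrable W)
    (h : ∀ φ : ℝ → ℂ, ContDiff ℝ ∞ φ → HasCompactSupport φ → tsupport φ ⊆ Ioo 0 δ →
      ∫ t, v t * φ t = ∫ t, W t * φ t) : ∀ᵐ t, t ∈ Ioo 0 δ → v t = W t := by
  have hsub : LocallyIntegrableOn (fun t ↦ v t - W t) (Ioo 0 δ) :=
    hv.sub (hW.locallyIntegrableOn _)
  have h0 := isOpen_Ioo.ae_eq_zero_of_integral_contDiff_smul_eq_zero hsub fun g hg hg' hsupp ↦ by
    have hprod {f : ℝ → ℂ} (hf : LocallyIntegrableOn f (Ioo 0 δ)) :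
        Integrable fun t ↦ f t * (g t : ℂ) := by
      have h1 : IntegrableOn f (tsupport g) := hf.integrableOn_compact_subset hsupp hg'
      have h2 : IntegrableOn (fun t ↦ f t * (g t : ℂ)) (tsupport g) :=
        h1.mul_continuousOn (by have := hg.continuous; fun_prop) hg'
      refine h2.integrable_of_forall_notMem_eq_zero fun t ht ↦ ?_
      rw [image_eq_zero_of_notMem_tsupport ht, Complex.ofReal_zero, mul_zero]
    have hsupp' : tsupport (fun t ↦ (g t : ℂ)) ⊆ Ioo 0 δ :=
      (tsupport_comp_subset Complex.ofReal_zero g).trans hsupp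
    have := h (fun t ↦ (g t : ℂ)) (Complex.ofRealCLM.contDiff.comp hg)
      (hg'.comp_left Complex.ofReal_zero) hsupp'
    simp only [Complex.real_smul, mul_comm _ (_ - _), sub_mul]
    rw [integral_sub (hprod hv) (hprod (hW.locallyIntegrableOn _)), this, sub_self]
  filter_upwards [h0] with t ht hmem
  exact sub_eq_zero.1 (ht hmem)

/-- Testing against φ supported in (0,δ) identifies u_k with V_k a.e. there, simultaneously for all
k by countability. Hence R(u) agrees with R(V) on (0,δ), and the latter has transform `extCoeff`. -/
theorem isExtension_extCoeff (hα : α ≠ 0) (hnr : NonResonant α β) {δ : ℝ} {v : ℤ → ℝ → ℂ}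
    (hG : ∀ k, Measurable (G k)) (hext : IsExtension δ v G)
    (hfin : ∑' k, weightedSq (phase α β k) (fun τ ↦ ‖G k τ‖ₑ) ≠ ⊤)
    (hmeas : ∀ k, AEStronglyMeasurable (extCoeff α β G k)) :
    IsExtension δ (fun k t ↦ rCoeff α β (fun j ↦ v j t) k) (extCoeff α β G) := by
  choose V hGV using fun k ↦ exists_isTransformPair (hG k) (ENNReal.ne_top_of_tsum_ne_top hfin k)
  have hvV : ∀ᵐ t, ∀ k, t ∈ Ioo 0 δ → v k t = V k t := by
    refine ae_all_iff.2 fun k ↦ ae_eq_of_isExtension (hext k).2.1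
      ((hGV k).memLp.locallyIntegrable one_le_two) fun φ hφ hφ' hsupp ↦ ?_
    rw [← (hext k).2.2 φ hφ hφ' hsupp]
    exact (hGV k).integral_eq φ (integrable_of_test hφ hφ') (memLp_of_test hφ hφ')
  have hR (k : ℤ) : ∀ᵐ t, t ∈ Ioo 0 δ →
      rCoeff α β (fun j ↦ V j t) k = rCoeff α β (fun j ↦ v j t) k := by
    filter_upwards [hvV] with t ht hmem
    simp only [fun j ↦ ht j hmem]
  refine fun k ↦ ⟨hmeas k, ?_, fun φ hφ hφ' hsupp ↦ ?_⟩
  · rw [locallyIntegrableOn_iff isOpen_Ioo.isLocallyClosed]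
    intro K hK hKc
    have h := (locallyIntegrable_rCoeff hα hnr hGV hfin k).integrableOn_isCompact hKc
    refine h.congr ?_
    rw [Filter.EventuallyEq, ae_restrict_iff' hKc.measurableSet]
    filter_upwards [hR k] with t ht hmem using ht (hK hmem)
  · rw [(integrable_rCoeff_mul_test hα hnr hGV hfin hφ hφ' k).2]
    refine integral_congr_ae ?_
    filter_upwards [hR k] with t ht
    by_cases hmem : t ∈ Ioo 0 δ
    · rw [ht hmem]
    · simp only [image_eq_zero_of_notMem_tsupport fun h ↦ hmem (hsupp h), mul_zero]

end Extension

/-! ### Passage to the infimum over extensions -/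

theorem IsExtension.exists_measurable {δ : ℝ} {v G : ℤ → ℝ → ℂ} (h : IsExtension δ v G)
    (α β : ℝ) : ∃ G' : ℤ → ℝ → ℂ, (∀ k, Measurable (G' k)) ∧ IsExtension δ v G' ∧
      ∑' k, weightedSq (phase α β k) (fun τ ↦ ‖G' k τ‖ₑ) = xNorm α β 0 (1 / 2) G ^ 2 := by
  -- Borel representatives change neither the pairing nor the norm, and the convolution estimates
  -- need them.
  refine ⟨fun k ↦ (h k).1.mk, fun k ↦ (h k).1.stronglyMeasurable_mk.measurable,
    fun k ↦ ⟨(h k).1.stronglyMeasurable_mk.aestronglyMeasurable, (h k).2.1,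
      fun φ hφ hφ' hsupp ↦ ?_⟩, ?_⟩
  · rw [← (h k).2.2 φ hφ hφ' hsupp]
    refine integral_congr_ae ?_
    filter_upwards [(h k).1.ae_eq_mk] with τ hτ
    rw [hτ]
  · rw [xNorm_zero_half_sq]
    refine tsum_congr fun k ↦ lintegral_congr_ae ?_
    filter_upwards [(h k).1.ae_eq_mk] with τ hτ
    rw [hτ]

theorem rSpaceCoeff_estimate {α β : ℝ} (hα : α ≠ 0) (hnr : NonResonant α β) :
    ∃ C : ℝ, 0 < C ∧ ∀ ε : ℝ, ε ≤ 1 / 8 → ∀ s : ℝ, s ≤ 2 → ∀ (δ : ℝ) (u : ℝ → Torus → ℂ),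
      xRestrNorm α β δ s (-1 / 2 + ε) (rSpaceCoeff α β u) ≤
        ENNReal.ofReal C * xRestrNorm α β δ 0 (1 / 2) (spaceCoeff u) ^ 3 := by
  obtain ⟨C, hC, hbound⟩ := exists_extMajorant_bound hα hnr
  refine ⟨C, hC, fun ε hε s hs δ u ↦ ?_⟩
  have hC0 : ENNReal.ofReal C ≠ 0 := by simpa using hC
  have key (G : ℤ → ℝ → ℂ) (hext : IsExtension δ (spaceCoeff u) G) :
      xRestrNorm α β δ s (-1 / 2 + ε) (rSpaceCoeff α β u) ≤
        ENNReal.ofReal C * xNorm α β 0 (1 / 2) G ^ 3 := by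
    obtain ⟨G', hG', hext', hnorm⟩ := hext.exists_measurable α β
    rcases eq_or_ne (xNorm α β 0 (1 / 2) G) ⊤ with htop | htop
    · rw [htop, ENNReal.top_pow three_ne_zero, ENNReal.mul_top hC0]
      exact le_top
    have hb := hbound G' hG'
    have hfin : ∑' k, weightedSq (phase α β k) (fun τ ↦ ‖G' k τ‖ₑ) ≠ ⊤ := by
      rw [hnorm]; exact ENNReal.pow_ne_top htop
    have hmeas := aestronglyMeasurable_extCoeff hG' (ne_top_of_le_ne_top (by finiteness) hb)
    have hE := isExtension_extCoeff hα hnr hG' hext' hfin hmeas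
    refine (iInf₂_le (extCoeff α β G') hE).trans (xNorm_extCoeff_le hs hε hG' (hb.trans ?_))
    rw [hnorm]
    exact le_of_eq (by ring)
  -- The cube is inverted so that the bound for each extension becomes a lower bound for its norm
  -- and passes to the infimum.
  have hinf : (xRestrNorm α β δ s (-1 / 2 + ε) (rSpaceCoeff α β u) / ENNReal.ofReal C) ^
      (1 / 3 : ℝ) ≤ xRestrNorm α β δ 0 (1 / 2) (spaceCoeff u) := by
    refine le_iInf₂ fun G hext ↦ ?_
    rw [one_div, ENNReal.rpow_inv_le_iff (by norm_num),
      ENNReal.div_le_iff' hC0 ENNReal.ofReal_ne_top]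
    exact_mod_cast key G hext
  rw [one_div, ENNReal.rpow_inv_le_iff (by norm_num),
    ENNReal.div_le_iff' hC0 ENNReal.ofReal_ne_top] at hinf
  exact_mod_cast hinf

theorem ae_summable_rTerm {α β : ℝ} (hα : α ≠ 0) (hnr : NonResonant α β) {δ : ℝ}
    {u : ℝ → Torus → ℂ} (hu : IsDotL2SpaceTime δ u) :
    ∀ᵐ t ∂(volume.restrict (Icc 0 δ)), ∀ k : ℤ, k ≠ 0 →
      Summable (rTerm α β (fourierCoeff (u t)) k) := by
  have hm := hu.1.1
  have hfin : ∫⁻ z, ‖Function.uncurry u z‖ₑ ^ 2 ∂((volume.restrict (Icc 0 δ)).prod volume) ≠ ⊤ := by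
    rw [← eLpNorm_two_sq]
    exact ENNReal.pow_ne_top hu.1.2.ne
  -- By Tonelli u(t) is in L² of the torus for almost every t, where the fixed-time convergence
  -- applies.
  rw [lintegral_prod _ (hm.enorm.pow_const 2)] at hfin
  filter_upwards [hm.prodMk_left,
    ae_lt_top' (hm.enorm.pow_const 2).lintegral_prod_right' hfin] with t ht1 ht2 k _
  exact summable_rTerm hα hnr (memLp_two_of_lintegral ht1 ht2.ne) k

end Kawahara

theorem proposition4p2 :
    ∃ ε₀ : ℝ, 0 < ε₀ ∧ ∀ α β : ℝ, α ≠ 0 → Kawahara.NonResonant α β →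
      -- the bilinear estimate
      (∃ C : ℝ, 0 < C ∧ ∀ s : ℝ, s ≤ 3 → ∀ φ ψ : Kawahara.Torus → ℂ,
        Kawahara.IsDotL2 φ → Kawahara.IsDotL2 ψ →
          (∀ k : ℤ, k ≠ 0 →
            Summable (Kawahara.bTerm α β (fourierCoeff φ) (fourierCoeff ψ) k)) ∧
          Kawahara.hsNorm s (Kawahara.bCoeff α β (fourierCoeff φ) (fourierCoeff ψ)) ≤
            ENNReal.ofReal C * Kawahara.l2Norm φ * Kawahara.l2Norm ψ) ∧
      -- the resonant term `ρ`
      (∃ C : ℝ, 0 < C ∧ ∀ s : ℝ, s ≤ 3 → ∀ u : Kawahara.Torus → ℂ, Kawahara.IsDotL2 u →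
          Kawahara.hsNorm s (Kawahara.rhoCoeff α β (fourierCoeff u)) ≤
            ENNReal.ofReal C * Kawahara.l2Norm u ^ 3) ∧
      -- the resonant term `σ`
      (∃ C : ℝ, 0 < C ∧ ∀ s : ℝ, s ≤ 2 → ∀ u : Kawahara.Torus → ℂ, Kawahara.IsDotL2 u →
          (∀ k : ℤ, k ≠ 0 → Summable (Kawahara.sigmaTerm α β (fourierCoeff u) k)) ∧
          Kawahara.hsNorm s (Kawahara.sigmaCoeff α β (fourierCoeff u)) ≤
            ENNReal.ofReal C * Kawahara.l2Norm u ^ 3) ∧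
      -- the nonresonant term `R`
      (∀ ε : ℝ, 0 < ε → ε ≤ ε₀ → ∃ C : ℝ, 0 < C ∧ ∀ s : ℝ, s ≤ 2 → ∀ δ : ℝ, 0 ≤ δ →
        ∀ u : ℝ → Kawahara.Torus → ℂ, Kawahara.IsDotL2SpaceTime δ u →
          (∀ᵐ t ∂(MeasureTheory.volume.restrict (Set.Icc 0 δ)), ∀ k : ℤ, k ≠ 0 →
            Summable (Kawahara.rTerm α β (fourierCoeff (u t)) k)) ∧
          Kawahara.xRestrNorm α β δ s (-1 / 2 + ε) (Kawahara.rSpaceCoeff α β u) ≤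
            ENNReal.ofReal C *
              Kawahara.xRestrNorm α β δ 0 (1 / 2) (Kawahara.spaceCoeff u) ^ 3) := by
  -- The output weight in the trilinear estimate is ⟨·⟩^(-3/8), and -1/2 + ε ≤ -3/8 exactly when ε ≤
  -- 1/8.
  refine ⟨1 / 8, by norm_num, fun α β hα hnr ↦ ⟨Kawahara.bCoeff_estimate hα hnr,
    Kawahara.rhoCoeff_estimate hα hnr, Kawahara.sigmaCoeff_estimate hα hnr, fun ε _ hε ↦ ?_⟩⟩
  obtain ⟨C, hC, hR⟩ := Kawahara.rSpaceCoeff_estimate hα hnr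
  exact ⟨C, hC, fun s hs δ _ u hu ↦
    ⟨Kawahara.ae_summable_rTerm hα hnr hu, hR ε hε s hs δ u⟩⟩
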